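/- Let $T>0$ and let $P,Q\in L^\infty(\mathbb R^3)^{3\times 3}$ be complex matrix-valued functions which are Hermitian a.e. and uniformly elliptic: there is $\alpha>0$ such that $$\min\{P(x)\xi\cdot\overline\xi,\ Q(x)\xi\cdot\overline\xi\}\ge\alpha|\xi|^2\qquad\text{for all }\xi\in\mathbb C^3\text{ and a.e. }x\in\mathbb R^3 ,$$ where $\xi\cdot\eta=\sum_{j}\xi_j\eta_j$. Functions are complex valued, and $L^p(0,T;L^2(\mathbb R^3)^3)$ denotes the Bochner space. Then for all $f,g\in L^1(0,T;L^2(\mathbb R^3)^3)$ and all $E^0,B^0\in L^2(\mathbb R^3)^3$ there is a unique pair $(E,B)\in[L^\infty(0,T;L^2(\mathbb R^3)^3)]^2$ solving $$\partial_tB+\operatorname{curl}E=f,\qquad P\,\partial_tE-\operatorname{curl}(Q^{-1}B)=g\quad\text{in }(0,T)\times\mathbb R^3,\qquad B|_{t=0}=B^0,\quad E|_{t=0}=E^0$$ in the weak sense, that is, such that for every $\varphi\in C_c^\infty((-\infty,T)\times\mathbb R^3;\mathbb C^3)$ $$\int_0^T\!\!\int_{\mathbb R^3}\big(-B\cdot\partial_t\overline\varphi+E\cdot\operatorname{curl}\overline\varphi\big)\,dx\,dt=\int_0^T\!\!\int_{\mathbb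 R^3} f\cdot\overline\varphi\,dx\,dt+\int_{\mathbb R^3} B^0\cdot\overline{\varphi(0,\cdot)}\,dx,$$ $$\int_0^T\!\!\int_{\mathbb R^3}\big(-PE\cdot\partial_t\overline\varphi-Q^{-1}B\cdot\operatorname{curl}\overline\varphi\big)\,dx\,dt=\int_0^T\!\!\int_{\mathbb R^3} g\cdot\overline\varphi\,dx\,dt+\int_{\mathbb R^3} PE^0\cdot\overline{\varphi(0,\cdot)}\,dx.$$ Moreover, this solution satisfies the energy identity $$\frac12\frac{d}{dt}\int_{\mathbb R^3}\big(Q^{-1}B\cdot\overline B+PE\cdot\overline E\big)\,dx=\int_{\mathbb R^3}\operatorname{Re}\big(Q^{-1}f\cdot\overline B+g\cdot\overline E\big)\,dx\quad\text{in }(0,T),$$ in the following sense: the function $t\mapsto\frac12\int_{\mathbb R^3}(Q^{-1}B\cdot\overline B+PE\cdot\overline E)\,dx$ coincides for a.e. $t\in(0,T)$ with an absolutely continuous function on $[0,T]$ whose value at $t=0$ is $\frac12\int_{\mathbb R^3}(Q^{-1}B^0\cdot\overline{B^0}+PE^0\cdot\overline{E^0})\,dx$ and whose derivative is the right-hand side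 for a.e. $t\in(0,T)$. -/

import Mathlib

open MeasureTheory Set
open scoped ENNReal ContDiff

noncomputable section

namespace Maxwell

/-- Physical space `ℝ³`. -/
abbrev R3 : Type := EuclideanSpace ℝ (Fin 3)

/-- Complex vectors `ℂ³` with the Hermitian norm. With Mathlib's convention
`inner ℂ η ξ = ∑ j, ξ j * conj (η j)`, the scalar product `ξ · η̄` is `inner ℂ η ξ`. -/
abbrev C3 : Type := EuclideanSpace ℂ (Fin 3)

/-- `L²(ℝ³)³`, complex valued. -/
abbrev L2 : Type := Lp C3 2 (volume : Measure R3)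

/-- The Bochner space `L^p(0,T; L²(ℝ³)³)`. -/
abbrev LpL2 (p : ℝ≥0∞) (T : ℝ) : Type :=
  Lp L2 p ((volume : Measure ℝ).restrict (Ioo 0 T))

/-- The matrix-vector product `A ξ` in `ℂ³`. -/
def act (A : Matrix (Fin 3) (Fin 3) ℂ) (ξ : C3) : C3 := WithLp.toLp 2 (A.mulVec ξ.ofLp)

/-- `A ∈ L^∞(ℝ³)^{3×3}`. -/
def IsBoundedCoeff (A : R3 → Matrix (Fin 3) (Fin 3) ℂ) : Prop :=
  ∀ i j, MemLp (fun x => A x i j) ∞ volume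

/-- `A(x)` is Hermitian for a.e. `x`. -/
def IsHermitianCoeff (A : R3 → Matrix (Fin 3) (Fin 3) ℂ) : Prop :=
  ∀ᵐ x, (A x).IsHermitian

/-- `min {P(x)ξ·ξ̄, Q(x)ξ·ξ̄} ≥ α |ξ|²` for all `ξ ∈ ℂ³` and a.e. `x ∈ ℝ³`, for some `α > 0`
(for Hermitian matrices the two products are real, so taking real parts changes nothing). -/
def UniformlyElliptic (P Q : R3 → Matrix (Fin 3) (Fin 3) ℂ) : Prop :=
  ∃ α : ℝ, 0 < α ∧ ∀ᵐ x : R3, ∀ ξ : C3,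
    α * ‖ξ‖ ^ 2 ≤ min (inner ℂ ξ (act (P x) ξ)).re (inner ℂ ξ (act (Q x) ξ)).re

/-- The partial derivative `∂ⱼ vₖ (x)`. -/
def pderiv (v : R3 → C3) (j k : Fin 3) (x : R3) : ℂ :=
  fderiv ℝ (fun y => v y k) x (EuclideanSpace.single j 1)

/-- The curl of a (smooth) field `v : ℝ³ → ℂ³`, the components being indexed by `0, 1, 2`. -/
def curl (v : R3 → C3) (x : R3) : C3 :=
  !₂[pderiv v 1 2 x - pderiv v 2 1 x,
     pderiv v 2 0 x - pderiv v 0 2 x,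
     pderiv v 0 1 x - pderiv v 1 0 x]

/-- Test fields `φ ∈ C_c^∞((-∞,T) × ℝ³; ℂ³)`. Restricted to `t ≥ 0` they are the test fields on
`[0,T) × ℝ³`: they vanish near `t = T` but need not vanish at `t = 0`. -/
structure IsTestField (T : ℝ) (φ : ℝ → R3 → C3) : Prop where
  smooth : ContDiff ℝ ∞ (Function.uncurry φ)
  compact : HasCompactSupport (Function.uncurry φ)
  support : tsupport (Function.uncurry φ) ⊆ Iio T ×ˢ univ

/-- `(E,B)` solves, in the sense of distributions and with the initial conditions,
`∂ₜB + curl E = f`, `P ∂ₜE - curl (Q⁻¹B) = g` in `(0,T) × ℝ³`, `B|ₜ₌₀ = B⁰`, `E|ₜ₌₀ = E⁰`.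
The equations are tested with the complex conjugates of test fields. As `P` is independent of
time, `P ∂ₜE` is the distribution `∂ₜ(PE)`. -/
structure IsWeakSolution (T : ℝ) (P Q : R3 → Matrix (Fin 3) (Fin 3) ℂ)
    (f g : LpL2 1 T) (E₀ B₀ : L2) (E B : LpL2 ∞ T) : Prop where
  faraday : ∀ φ : ℝ → R3 → C3, IsTestField T φ →
    (∫ t in Ioo 0 T, ∫ x, (-inner ℂ (deriv (fun s => φ s x) t) (B t x)
        + inner ℂ (curl (φ t) x) (E t x)))
      = (∫ t in Ioo 0 T, ∫ x, inner ℂ (φ t x) (f t x)) + ∫ x, inner ℂ (φ 0 x) (B₀ x)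
  ampere : ∀ φ : ℝ → R3 → C3, IsTestField T φ →
    (∫ t in Ioo 0 T, ∫ x, (-inner ℂ (deriv (fun s => φ s x) t) (act (P x) (E t x))
        - inner ℂ (curl (φ t) x) (act (Q x)⁻¹ (B t x))))
      = (∫ t in Ioo 0 T, ∫ x, inner ℂ (φ t x) (g t x))
        + ∫ x, inner ℂ (φ 0 x) (act (P x) (E₀ x))

/-- The energy `½ ∫ (Q⁻¹B·B̄ + PE·Ē) dx` (the integrand is real for Hermitian `P`, `Q`). -/
def energy (P Q : R3 → Matrix (Fin 3) (Fin 3) ℂ) (E B : L2) : ℝ :=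
  (1 / 2) * ∫ x, (inner ℂ (B x) (act (Q x)⁻¹ (B x)) + inner ℂ (E x) (act (P x) (E x))).re

/-- The power `∫ Re (Q⁻¹f·B̄ + g·Ē) dx` of the sources. -/
def power (Q : R3 → Matrix (Fin 3) (Fin 3) ℂ) (f g E B : L2) : ℝ :=
  ∫ x, (inner ℂ (B x) (act (Q x)⁻¹ (f x)) + inner ℂ (E x) (g x)).re

/-- The energy identity `d/dt energy = power` in `(0,T)`. The energy of an element of
`L^∞(0,T; L²)²` is defined for a.e. `t` only; the identity says that it has an absolutely
continuous representative on `[0,T]`, which starts from the energy of the initial data and whose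
derivative is the power a.e. in `(0,T)`. -/
def EnergyIdentity (T : ℝ) (P Q : R3 → Matrix (Fin 3) (Fin 3) ℂ)
    (f g : LpL2 1 T) (E₀ B₀ : L2) (E B : LpL2 ∞ T) : Prop :=
  ∃ e : ℝ → ℝ, AbsolutelyContinuousOnInterval e 0 T ∧
    e 0 = energy P Q E₀ B₀ ∧
    (∀ᵐ t ∂(volume : Measure ℝ).restrict (Ioo 0 T), e t = energy P Q (E t) (B t)) ∧
    (∀ᵐ t ∂(volume : Measure ℝ).restrict (Ioo 0 T),
      HasDerivAt e (power Q (f t) (g t) (E t) (B t)) t)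

end Maxwell

end

/- With `p² = P` and `r² = Q⁻¹`, the unknowns `e = p E` and `b = r B` turn the system into
`u' = A u + F`, where the energy is `‖u‖² / 2` and `A` is skew-adjoint because the curl is a
self-adjoint operator in `L²`: by the Fourier transform it is the multiplication by the Hermitian
matrices `2πi ξ ×`. The operator `A` generates a unitary group `U`, and the mild solution
`u t = U t (u₀ + ∫₀ᵗ U (-s) (F s) ds)` is a weak solution. Since `v t = U (-t) (u t)` is absolutely
continuous with derivative `U (-t) (F t)` a.e., the energy identity follows from `‖u t‖ = ‖v t‖`.
For uniqueness, a weak solution with vanishing data, smeared out in time by the translates of a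
test function, becomes a differentiable curve in the domain of `A` whose norm is constant and which
vanishes at the end. -/

noncomputable section

namespace Maxwell

section SkewAdjointGraph

open Filter Topology

variable {H : Type*} [NormedAddCommGroup H] [InnerProductSpace ℂ H]

/-- `G` is the graph of a skew-adjoint operator `A = -A*` in `H`. Unbounded operators are encoded
by their graphs: the first condition is `A = -A*`, the second one, that `G` is single valued, then
amounts to the density of the domain. -/
structure IsSkewAdjointGraph (G : Submodule ℂ (H × H)) : Prop where
  mem_iff (p : H × H) : p ∈ G ↔ ∀ q ∈ G, inner ℂ q.2 p.1 + inner ℂ q.1 p.2 = 0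
  eq_zero_of_zero_mem {y : H} : (0, y) ∈ G → y = 0

namespace IsSkewAdjointGraph

variable {G : Submodule ℂ (H × H)} {x y z : H} {k : ℝ}

lemma eq_of_mem (hG : IsSkewAdjointGraph G) (hy : (x, y) ∈ G) (hz : (x, z) ∈ G) : y = z :=
  sub_eq_zero.1 <| hG.eq_zero_of_zero_mem <| by simpa using sub_mem hy hz

lemma re_inner_eq_zero (hG : IsSkewAdjointGraph G) (h : (x, y) ∈ G) : (inner ℂ x y).re = 0 := by
  have h₀ := congrArg Complex.re ((hG.mem_iff _).1 h _ h)
  have h₁ : (inner ℂ y x).re = (inner ℂ x y).re := inner_re_symm (𝕜 := ℂ) y x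
  rw [Complex.add_re, h₁, Complex.zero_re] at h₀
  linarith

lemma isClosed (hG : IsSkewAdjointGraph G) : IsClosed (G : Set (H × H)) := by
  have h : (G : Set (H × H)) = ⋂ q ∈ G, {p | inner ℂ q.2 p.1 + inner ℂ q.1 p.2 = 0} := by
    ext p
    simpa using hG.mem_iff p
  rw [h]
  exact isClosed_biInter fun q _ => isClosed_eq (by fun_prop) continuous_const

lemma norm_sub_inv_smul_sq (hG : IsSkewAdjointGraph G) (k : ℝ) (h : (x, y) ∈ G) :
    ‖x - k⁻¹ • y‖ ^ 2 = ‖x‖ ^ 2 + k⁻¹ ^ 2 * ‖y‖ ^ 2 := by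
  have hxy : RCLike.re (inner ℂ x (k⁻¹ • y)) = 0 := by
    have := hG.re_inner_eq_zero h
    rw [inner_smul_right_eq_smul]
    simp [this]
  rw [norm_sub_sq (𝕜 := ℂ), hxy, norm_smul, mul_pow, Real.norm_eq_abs, sq_abs]
  ring

/-- The operator `1 - A / k` on the graph of `A`. -/
def subInvSmul (G : Submodule ℂ (H × H)) (k : ℝ) : G →L[ℂ] H :=
  (ContinuousLinearMap.fst ℂ H H - k⁻¹ • ContinuousLinearMap.snd ℂ H H) ∘L G.subtypeL

lemma subInvSmul_apply (k : ℝ) (p : G) : subInvSmul G k p = p.1.1 - k⁻¹ • p.1.2 := rfl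

lemma norm_le_mul_norm_subInvSmul (hG : IsSkewAdjointGraph G) (hk : k ≠ 0) (p : G) :
    ‖p‖ ≤ max 1 |k| * ‖subInvSmul G k p‖ := by
  have h := hG.norm_sub_inv_smul_sq k p.2
  rw [subInvSmul_apply]
  have h₁ : ‖p.1.1‖ ≤ ‖p.1.1 - k⁻¹ • p.1.2‖ :=
    abs_le_of_sq_le_sq' (by rw [h]; exact le_add_of_nonneg_right (by positivity)) (norm_nonneg _)
      |>.2
  have h₂ : ‖p.1.2‖ ≤ |k| * ‖p.1.1 - k⁻¹ • p.1.2‖ := by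
    refine abs_le_of_sq_le_sq' ?_ (by positivity) |>.2
    rw [mul_pow, h, sq_abs, mul_add, inv_pow, mul_inv_cancel_left₀ (pow_ne_zero 2 hk)]
    exact le_add_of_nonneg_left (by positivity)
  refine max_le (h₁.trans ?_) (h₂.trans ?_)
  · exact le_mul_of_one_le_left (norm_nonneg _) (le_max_left _ _)
  · exact mul_le_mul_of_nonneg_right (le_max_right _ _) (norm_nonneg _)

lemma antilipschitz_subInvSmul (hG : IsSkewAdjointGraph G) (hk : k ≠ 0) :
    AntilipschitzWith (max 1 |k|).toNNReal (subInvSmul G k) := by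
  refine (subInvSmul G k).antilipschitz_of_bound fun p => ?_
  rw [Real.coe_toNNReal _ (by positivity)]
  exact hG.norm_le_mul_norm_subInvSmul hk p

variable [CompleteSpace H]

lemma dense_domain (hG : IsSkewAdjointGraph G) : Dense (Prod.fst '' (G : Set (H × H))) := by
  refine (G.map (LinearMap.fst ℂ H H)).dense_iff_topologicalClosure_eq_top.2 <|
    (Submodule.topologicalClosure_eq_top_iff).2 <| (Submodule.eq_bot_iff _).2 fun y hy => ?_
  refine hG.eq_zero_of_zero_mem ((hG.mem_iff _).2 fun q hq => ?_)
  rw [inner_zero_right, zero_add]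
  exact (Submodule.mem_orthogonal _ _).1 hy _ ⟨q, hq, rfl⟩

lemma range_subInvSmul (hG : IsSkewAdjointGraph G) (hk : k ≠ 0) :
    (subInvSmul G k).range = ⊤ := by
  have : CompleteSpace G := hG.isClosed.completeSpace_coe
  have hc : IsClosed ((subInvSmul G k).range : Set H) :=
    (hG.antilipschitz_subInvSmul hk).isClosed_range (subInvSmul G k).uniformContinuous
  rw [← hc.submodule_topologicalClosure_eq, Submodule.topologicalClosure_eq_top_iff,
    Submodule.eq_bot_iff]
  intro y hy
  have horth (q : H × H) (hq : q ∈ G) : inner ℂ q.1 y = k⁻¹ • inner ℂ q.2 y := by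
    have := (Submodule.mem_orthogonal _ _).1 hy _ ⟨⟨q, hq⟩, rfl⟩
    change inner ℂ (q.1 - k⁻¹ • q.2) y = 0 at this
    rwa [inner_sub_left, inner_smul_left_eq_smul, sub_eq_zero] at this
  have hmem : (y, -(k • y)) ∈ G := (hG.mem_iff _).2 fun q hq => by
    rw [inner_neg_right, inner_smul_right_eq_smul, horth q hq, smul_inv_smul₀ hk, add_neg_cancel]
  have h₀ := hG.re_inner_eq_zero hmem
  rw [inner_neg_right, inner_smul_right_eq_smul, Complex.neg_re, Complex.smul_re, neg_eq_zero,
    smul_eq_zero_iff_right hk] at h₀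
  exact (re_inner_self_nonpos (𝕜 := ℂ)).1 h₀.le

/-- `1 - A / k` as an isomorphism from the graph of `A` onto the whole space. -/
def subInvSmulEquiv (hG : IsSkewAdjointGraph G) (hk : k ≠ 0) : G ≃L[ℂ] H :=
  have : CompleteSpace G := hG.isClosed.completeSpace_coe
  .ofBijective (subInvSmul G k)
    (LinearMap.ker_eq_bot.2 (hG.antilipschitz_subInvSmul hk).injective) (hG.range_subInvSmul hk)

/-- The contraction `(1 - A / k)⁻¹`. -/
def resolvent (hG : IsSkewAdjointGraph G) (hk : k ≠ 0) : H →L[ℂ] H :=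
  ContinuousLinearMap.fst ℂ H H ∘L G.subtypeL ∘L (hG.subInvSmulEquiv hk).symm

lemma resolvent_mem (hG : IsSkewAdjointGraph G) (hk : k ≠ 0) (y : H) :
    (hG.resolvent hk y, k • (hG.resolvent hk y - y)) ∈ G := by
  set p := (hG.subInvSmulEquiv hk).symm y
  have hy : p.1.1 - k⁻¹ • p.1.2 = y := (hG.subInvSmulEquiv hk).apply_symm_apply y
  have h₂ : k • (hG.resolvent hk y - y) = p.1.2 := by
    change k • (p.1.1 - y) = p.1.2
    rw [← hy, sub_sub_cancel, smul_inv_smul₀ hk]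
  rw [h₂]
  exact p.2

lemma eq_resolvent (hG : IsSkewAdjointGraph G) (hk : k ≠ 0) (h : (x, k • (x - y)) ∈ G) :
    x = hG.resolvent hk y := by
  have hd : (x - hG.resolvent hk y, k • (x - hG.resolvent hk y)) ∈ G := by
    convert sub_mem h (hG.resolvent_mem hk y) using 1
    rw [Prod.mk_sub_mk, ← smul_sub, sub_sub_sub_cancel_right]
  have h₀ := hG.re_inner_eq_zero hd
  rw [inner_smul_right_eq_smul, Complex.smul_re, smul_eq_zero_iff_right hk] at h₀
  exact sub_eq_zero.1 ((re_inner_self_nonpos (𝕜 := ℂ)).1 h₀.le)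

lemma norm_resolvent_le (hG : IsSkewAdjointGraph G) (hk : k ≠ 0) (y : H) :
    ‖hG.resolvent hk y‖ ≤ ‖y‖ := by
  have h := hG.norm_sub_inv_smul_sq k (hG.resolvent_mem hk y)
  rw [inv_smul_smul₀ hk, sub_sub_cancel] at h
  exact abs_le_of_sq_le_sq' (by rw [h]; exact le_add_of_nonneg_right (by positivity))
    (norm_nonneg _) |>.2

lemma inner_resolvent_left (hG : IsSkewAdjointGraph G) (hk : k ≠ 0) (x y : H) :
    inner ℂ (hG.resolvent hk x) y = inner ℂ x (hG.resolvent (neg_ne_zero.2 hk) y) := by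
  have h := (hG.mem_iff _).1 (hG.resolvent_mem (neg_ne_zero.2 hk) y) _ (hG.resolvent_mem hk x)
  simp only [inner_smul_left_eq_smul, inner_smul_right_eq_smul, neg_smul, ← sub_eq_add_neg,
    ← smul_sub, smul_eq_zero_iff_right hk, inner_sub_left, inner_sub_right, inner_neg_right] at h
  linear_combination h

lemma resolvent_mem_of_mem (hG : IsSkewAdjointGraph G) (hk : k ≠ 0) (h : (x, y) ∈ G) :
    (hG.resolvent hk x, hG.resolvent hk y) ∈ G := by
  have hmem := hG.resolvent_mem hk x
  set w := hG.resolvent hk x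
  have hw : k • (w - x) = hG.resolvent hk y := hG.eq_resolvent hk <| by
    have := G.smul_mem (k : ℂ) (sub_mem hmem h)
    rwa [Prod.mk_sub_mk, Prod.smul_mk, Complex.coe_smul, Complex.coe_smul] at this
  exact hw ▸ hmem

lemma commute_resolvent (hG : IsSkewAdjointGraph G) {l : ℝ} (hk : k ≠ 0) (hl : l ≠ 0) :
    Commute (hG.resolvent hk) (hG.resolvent hl) := by
  ext y
  refine hG.eq_resolvent hl ?_
  have := hG.resolvent_mem_of_mem hk (hG.resolvent_mem hl y)
  rwa [ContinuousLinearMap.map_smul_of_tower, map_sub] at this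

/-- The Yosida approximation `A (1 - A² / k²)⁻¹`, a bounded skew-adjoint operator. -/
def yosida (hG : IsSkewAdjointGraph G) (hk : k ≠ 0) : H →L[ℂ] H :=
  (k / 2) • (hG.resolvent hk - hG.resolvent (neg_ne_zero.2 hk))

lemma yosida_mem_skewAdjoint (hG : IsSkewAdjointGraph G) (hk : k ≠ 0) :
    hG.yosida hk ∈ skewAdjoint (H →L[ℂ] H) := by
  rw [skewAdjoint.mem_iff, ContinuousLinearMap.star_eq_adjoint, eq_comm,
    ContinuousLinearMap.eq_adjoint_iff]
  intro x y
  have h := hG.inner_resolvent_left (neg_ne_zero.2 hk) x y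
  simp only [neg_neg] at h
  simp only [yosida, neg_apply, smul_apply, sub_apply, inner_neg_left, inner_smul_left_eq_smul,
    inner_smul_right_eq_smul, inner_sub_left, inner_sub_right, h, hG.inner_resolvent_left hk]
  rw [← smul_neg, neg_sub]

lemma commute_yosida (hG : IsSkewAdjointGraph G) {l : ℝ} (hk : k ≠ 0) (hl : l ≠ 0) :
    Commute (hG.yosida hk) (hG.yosida hl) :=
  ((((hG.commute_resolvent _ _).sub_right (hG.commute_resolvent _ _)).sub_left
    ((hG.commute_resolvent _ _).sub_right (hG.commute_resolvent _ _))).smul_left _).smul_right _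

lemma yosida_apply_of_mem (hG : IsSkewAdjointGraph G) (hk : k ≠ 0) (h : (x, y) ∈ G) :
    hG.yosida hk x =
      (2⁻¹ : ℝ) • (hG.resolvent hk y + hG.resolvent (neg_ne_zero.2 hk) y) := by
  have hA {l : ℝ} (hl : l ≠ 0) : hG.resolvent hl y = l • (hG.resolvent hl x - x) :=
    hG.eq_of_mem (hG.resolvent_mem_of_mem hl h) (hG.resolvent_mem hl x)
  rw [hA hk, hA (neg_ne_zero.2 hk), yosida, smul_apply, sub_apply]
  module

lemma tendsto_resolvent (hG : IsSkewAdjointGraph G) {k : ℕ → ℝ} (hk : ∀ n, k n ≠ 0)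
    (hlim : Tendsto (fun n => |k n|) atTop atTop) (y : H) :
    Tendsto (fun n => hG.resolvent (hk n) y) atTop (𝓝 y) := by
  have hequi : UniformEquicontinuous fun n => ⇑(hG.resolvent (hk n)) :=
    LipschitzWith.uniformEquicontinuous _ 1 fun n =>
      AddMonoidHomClass.lipschitz_of_bound_nnnorm _ _ fun x =>
        (hG.norm_resolvent_le (hk n) x).trans_eq (one_mul _).symm
  have hclosed := hequi.equicontinuous.isClosed_setOfPred_tendsto (l := atTop) continuous_id
  refine hG.dense_domain.induction ?_ hclosed y
  rintro _ ⟨⟨x, z⟩, hxz, rfl⟩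
  rw [tendsto_iff_norm_sub_tendsto_zero]
  have hbound (n : ℕ) : ‖hG.resolvent (hk n) x - x‖ ≤ |k n|⁻¹ * ‖z‖ := by
    have hz : k n • (hG.resolvent (hk n) x - x) = hG.resolvent (hk n) z :=
      hG.eq_of_mem (hG.resolvent_mem _ x) (hG.resolvent_mem_of_mem _ hxz)
    rw [← inv_smul_smul₀ (hk n) (hG.resolvent (hk n) x - x), hz, norm_smul, norm_inv,
      Real.norm_eq_abs]
    exact mul_le_mul_of_nonneg_left (hG.norm_resolvent_le _ z) (by positivity)
  exact squeeze_zero (fun _ => norm_nonneg _) hbound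
    (by simpa using hlim.inv_tendsto_atTop.mul_const ‖z‖)

lemma tendsto_yosida (hG : IsSkewAdjointGraph G) {k : ℕ → ℝ} (hk : ∀ n, k n ≠ 0)
    (hlim : Tendsto (fun n => |k n|) atTop atTop) (h : (x, y) ∈ G) :
    Tendsto (fun n => hG.yosida (hk n) x) atTop (𝓝 y) := by
  have h₁ := hG.tendsto_resolvent hk hlim y
  have h₂ := hG.tendsto_resolvent (fun n => neg_ne_zero.2 (hk n)) (by simpa using hlim) y
  simp only [hG.yosida_apply_of_mem _ h]
  simpa [← two_smul ℝ] using (h₁.add h₂).const_smul (2⁻¹ : ℝ)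

end IsSkewAdjointGraph

end SkewAdjointGraph

section UnitaryGroup

open Filter Topology NormedSpace

variable {H : Type*} [NormedAddCommGroup H] [InnerProductSpace ℂ H] [CompleteSpace H]

section Exponential

variable {D D' : H →L[ℂ] H}

lemma norm_exp_smul_apply (hD : D ∈ skewAdjoint (H →L[ℂ] H)) (t : ℝ) (x : H) :
    ‖exp (t • D) x‖ = ‖x‖ := by
  let +nondep : NormedAlgebra ℚ (H →L[ℂ] H) := .restrictScalars ℚ ℂ _
  have htD : t • D ∈ skewAdjoint (H →L[ℂ] H) := skewAdjoint.smul_mem t hD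
  have hu : exp (t • D) ∈ unitary (H →L[ℂ] H) := exp_mem_unitary_of_mem_skewAdjoint htD
  exact ContinuousLinearMap.norm_map_of_mem_unitary hu x

lemma hasDerivAt_exp_smul_apply (D : H →L[ℂ] H) (t : ℝ) (x : H) :
    HasDerivAt (fun s : ℝ => exp (s • D) x) (exp (t • D) (D x)) t :=
  ((ContinuousLinearMap.apply ℂ H x).restrictScalars ℝ).hasFDerivAt.comp_hasDerivAt t
    (hasDerivAt_exp_smul_const D t)

lemma norm_exp_smul_apply_sub_self_le (hD : D ∈ skewAdjoint (H →L[ℂ] H)) (t : ℝ) (x : H) :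
    ‖exp (t • D) x - x‖ ≤ ‖D x‖ * |t| := by
  simpa using convex_univ.norm_image_sub_le_of_norm_hasDerivWithin_le
    (f := fun s : ℝ => exp (s • D) x) (x := 0) (y := t)
    (fun s _ => (hasDerivAt_exp_smul_apply D s x).hasDerivWithinAt)
    (fun s _ => (norm_exp_smul_apply hD s (D x)).le) (mem_univ _) (mem_univ _)

lemma norm_exp_smul_apply_sub_le (hD : D ∈ skewAdjoint (H →L[ℂ] H))
    (hD' : D' ∈ skewAdjoint (H →L[ℂ] H)) (hDD' : Commute D D') (t : ℝ) (x : H) :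
    ‖exp (t • D) x - exp (t • D') x‖ ≤ ‖D x - D' x‖ * |t| := by
  let +nondep : NormedAlgebra ℚ (H →L[ℂ] H) := .restrictScalars ℚ ℂ _
  have hsplit : exp (t • D) = exp (t • D') * exp (t • (D - D')) := by
    rw [← exp_add_of_commute, ← smul_add, add_sub_cancel]
    exact ((hDD'.symm.sub_right (Commute.refl D')).smul_left t).smul_right t
  rw [hsplit, mul_apply_eq_comp, ← map_sub, norm_exp_smul_apply hD']
  exact norm_exp_smul_apply_sub_self_le (sub_mem hD hD') t x

end Exponential

namespace IsSkewAdjointGraph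

variable {G : Submodule ℂ (H × H)} {x y : H}

/-- The unitary groups generated by a sequence of Yosida approximations. -/
def yosidaGroup (hG : IsSkewAdjointGraph G) (n : ℕ) (t : ℝ) : H →L[ℂ] H :=
  exp (t • hG.yosida (Nat.cast_add_one_ne_zero n : (n + 1 : ℝ) ≠ 0))

lemma norm_yosidaGroup_apply (hG : IsSkewAdjointGraph G) (n : ℕ) (t : ℝ) (x : H) :
    ‖hG.yosidaGroup n t x‖ = ‖x‖ :=
  norm_exp_smul_apply (hG.yosida_mem_skewAdjoint _) t x

lemma tendsto_yosida_nat (hG : IsSkewAdjointGraph G) (h : (x, y) ∈ G) :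
    Tendsto (fun n : ℕ => hG.yosida (Nat.cast_add_one_ne_zero n : (n + 1 : ℝ) ≠ 0) x) atTop
      (𝓝 y) :=
  hG.tendsto_yosida _ (tendsto_abs_atTop_atTop.comp
    (tendsto_atTop_add_const_right _ _ tendsto_natCast_atTop_atTop)) h

lemma uniformCauchySeqOn_yosidaGroup_apply (hG : IsSkewAdjointGraph G) (x : H) (r : ℝ) :
    UniformCauchySeqOn (fun n t => hG.yosidaGroup n t x) atTop (Metric.ball 0 r) := by
  refine Metric.uniformCauchySeqOn_iff.2 fun ε hε => ?_
  obtain ⟨_, ⟨⟨z, y⟩, hzy, rfl⟩, hz⟩ := hG.dense_domain.exists_dist_lt x (ε := ε / 3)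
    (by positivity)
  rw [dist_eq_norm_sub] at hz
  obtain ⟨N, hN⟩ := Metric.cauchySeq_iff.1 (hG.tendsto_yosida_nat hzy).cauchySeq
    (ε / (3 * (|r| + 1))) (by positivity)
  refine ⟨N, fun m hm n hn t ht => ?_⟩
  have hconst (n : ℕ) : ‖hG.yosidaGroup n t (x - z)‖ < ε / 3 :=
    (hG.norm_yosidaGroup_apply n t _).trans_lt hz
  have hdom : ‖hG.yosidaGroup m t z - hG.yosidaGroup n t z‖ ≤ ε / 3 := by
    refine (norm_exp_smul_apply_sub_le (hG.yosida_mem_skewAdjoint _) (hG.yosida_mem_skewAdjoint _)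
      (hG.commute_yosida _ _) t z).trans ?_
    have hmn := (dist_eq_norm_sub _ _).symm.trans_lt (hN m hm n hn)
    have ht' : |t| ≤ |r| + 1 := by
      rw [mem_ball_zero_iff, Real.norm_eq_abs] at ht
      linarith [le_abs_self r]
    refine (mul_le_mul hmn.le ht' (abs_nonneg _) (by positivity)).trans_eq ?_
    field_simp
  calc dist (hG.yosidaGroup m t x) (hG.yosidaGroup n t x)
      = ‖hG.yosidaGroup m t (x - z) - hG.yosidaGroup n t (x - z)
          + (hG.yosidaGroup m t z - hG.yosidaGroup n t z)‖ := by
        rw [dist_eq_norm_sub, map_sub, map_sub]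
        congr 1
        abel
    _ ≤ ‖hG.yosidaGroup m t (x - z)‖ + ‖hG.yosidaGroup n t (x - z)‖
          + ‖hG.yosidaGroup m t z - hG.yosidaGroup n t z‖ :=
        (norm_add_le _ _).trans (add_le_add_left (norm_sub_le _ _) _)
    _ < ε := by linarith [hconst m, hconst n]

lemma cauchySeq_yosidaGroup_apply (hG : IsSkewAdjointGraph G) (t : ℝ) (x : H) :
    CauchySeq fun n => hG.yosidaGroup n t x :=
  (hG.uniformCauchySeqOn_yosidaGroup_apply x (|t| + 1)).cauchySeq (by simp)

/-- The unitary group generated by a skew-adjoint operator (Stone's theorem), the strong limit of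
the groups generated by its Yosida approximations. -/
def unitaryGroup (hG : IsSkewAdjointGraph G) (t : ℝ) : H →L[ℂ] H :=
  continuousLinearMapOfTendsto (fun n => hG.yosidaGroup n t)
    (tendsto_pi_nhds.2 fun x => (hG.cauchySeq_yosidaGroup_apply t x).tendsto_limUnder)

lemma tendsto_yosidaGroup_apply (hG : IsSkewAdjointGraph G) (t : ℝ) (x : H) :
    Tendsto (fun n => hG.yosidaGroup n t x) atTop (𝓝 (hG.unitaryGroup t x)) :=
  (hG.cauchySeq_yosidaGroup_apply t x).tendsto_limUnder

lemma tendstoUniformlyOn_yosidaGroup_apply (hG : IsSkewAdjointGraph G) (x : H) (r : ℝ) :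
    TendstoUniformlyOn (fun n t => hG.yosidaGroup n t x) (hG.unitaryGroup · x) atTop
      (Metric.ball 0 r) :=
  (hG.uniformCauchySeqOn_yosidaGroup_apply x r).tendstoUniformlyOn_of_tendsto
    fun t _ => hG.tendsto_yosidaGroup_apply t x

lemma tendsto_yosidaGroup_apply_of_tendsto (hG : IsSkewAdjointGraph G) (t : ℝ) {u : ℕ → H}
    (hu : Tendsto u atTop (𝓝 x)) :
    Tendsto (fun n => hG.yosidaGroup n t (u n)) atTop (𝓝 (hG.unitaryGroup t x)) := by
  refine (hG.tendsto_yosidaGroup_apply t x).congr_dist ?_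
  simp only [dist_eq_norm_sub, ← map_sub, hG.norm_yosidaGroup_apply]
  exact tendsto_iff_norm_sub_tendsto_zero.1 hu |>.congr fun n => norm_sub_rev _ _

lemma norm_unitaryGroup_apply (hG : IsSkewAdjointGraph G) (t : ℝ) (x : H) :
    ‖hG.unitaryGroup t x‖ = ‖x‖ :=
  tendsto_nhds_unique (hG.tendsto_yosidaGroup_apply t x).norm
    (by simp only [hG.norm_yosidaGroup_apply, tendsto_const_nhds])

lemma unitaryGroup_zero (hG : IsSkewAdjointGraph G) : hG.unitaryGroup 0 = 1 := by
  ext x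
  refine tendsto_nhds_unique (hG.tendsto_yosidaGroup_apply 0 x) ?_
  simp [yosidaGroup]

lemma unitaryGroup_add_apply (hG : IsSkewAdjointGraph G) (s t : ℝ) (x : H) :
    hG.unitaryGroup (s + t) x = hG.unitaryGroup s (hG.unitaryGroup t x) := by
  let +nondep : NormedAlgebra ℚ (H →L[ℂ] H) := .restrictScalars ℚ ℂ _
  refine tendsto_nhds_unique (hG.tendsto_yosidaGroup_apply _ x) ?_
  have hadd (n : ℕ) : hG.yosidaGroup n (s + t) x = hG.yosidaGroup n s (hG.yosidaGroup n t x) := by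
    rw [yosidaGroup, add_smul, exp_add_of_commute
      (((Commute.refl (hG.yosida _)).smul_left s).smul_right t)]
    rfl
  simp only [hadd]
  exact hG.tendsto_yosidaGroup_apply_of_tendsto s (hG.tendsto_yosidaGroup_apply t x)

lemma continuous_unitaryGroup_apply (hG : IsSkewAdjointGraph G) (x : H) :
    Continuous fun t => hG.unitaryGroup t x := by
  have hloc : TendstoLocallyUniformly (fun n t => hG.yosidaGroup n t x) (hG.unitaryGroup · x)
      atTop := tendstoLocallyUniformly_iff_forall_isCompact.2 fun K hK => by
    obtain ⟨r, hr⟩ := hK.isBounded.subset_ball 0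
    exact (hG.tendstoUniformlyOn_yosidaGroup_apply x r).mono hr
  exact hloc.continuous <| .of_forall fun n => continuous_iff_continuousAt.2 fun t =>
    (hasDerivAt_exp_smul_apply _ t x).continuousAt

lemma hasDerivAt_unitaryGroup_apply (hG : IsSkewAdjointGraph G) (h : (x, y) ∈ G) (t : ℝ) :
    HasDerivAt (fun s => hG.unitaryGroup s x) (hG.unitaryGroup t y) t := by
  have hderiv : TendstoUniformlyOn
      (fun (n : ℕ) s => hG.yosidaGroup n s (hG.yosida (Nat.cast_add_one_ne_zero n) x))
      (hG.unitaryGroup · y) atTop (Metric.ball 0 (|t| + 1)) := by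
    have hgen : TendstoUniformlyOn
        (fun (n : ℕ) s => hG.yosidaGroup n s (hG.yosida (Nat.cast_add_one_ne_zero n) x - y))
        (fun _ => 0) atTop (Metric.ball 0 (|t| + 1)) := by
      refine Metric.tendstoUniformlyOn_iff.2 fun ε hε => ?_
      filter_upwards [Metric.tendsto_nhds.1 (hG.tendsto_yosida_nat h) ε hε] with n hn s _
      rwa [dist_zero_left, norm_yosidaGroup_apply, ← dist_eq_norm_sub]
    convert hgen.add (hG.tendstoUniformlyOn_yosidaGroup_apply y (|t| + 1)) using 1
    · ext n s
      simp
    · ext s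
      simp
  exact hasDerivAt_of_tendstoUniformlyOn Metric.isOpen_ball hderiv
    (.of_forall fun n s _ => hasDerivAt_exp_smul_apply _ s x)
    (fun s _ => hG.tendsto_yosidaGroup_apply s x) (by simp)

-- Unification would otherwise unfold the limit of exponentials, at great cost.
attribute [irreducible] unitaryGroup

end IsSkewAdjointGraph

end UnitaryGroup

section AbsoluteContinuity

open Filter Topology AbsolutelyContinuousOnInterval

variable {X Y Z : Type*} [PseudoMetricSpace X] [PseudoMetricSpace Y] [PseudoMetricSpace Z]
  {H : Type*} [NormedAddCommGroup H] [InnerProductSpace ℂ H] {a b : ℝ}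

lemma absolutelyContinuousOnInterval_of_dist_le {f : ℝ → X} {g : ℝ → Y} {h : ℝ → Z} {C D : ℝ}
    (hg : AbsolutelyContinuousOnInterval g a b) (hh : AbsolutelyContinuousOnInterval h a b)
    (hf : ∀ s ∈ uIcc a b, ∀ t ∈ uIcc a b,
      dist (f s) (f t) ≤ C * dist (g s) (g t) + D * dist (h s) (h t)) :
    AbsolutelyContinuousOnInterval f a b := by
  have hlim := (Tendsto.const_mul C hg).add (Tendsto.const_mul D hh)
  simp only [mul_zero, add_zero] at hlim
  refine squeeze_zero' (.of_forall fun _ => Finset.sum_nonneg fun _ _ => dist_nonneg) ?_ hlim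
  filter_upwards [mem_inf_of_right (mem_principal_self _)] with I hI
  rw [Finset.mul_sum, Finset.mul_sum, ← Finset.sum_add_distrib]
  exact Finset.sum_le_sum fun i hi => hf _ (hI.1 i hi).1 _ (hI.1 i hi).2

lemma absolutelyContinuousOnInterval_const (c : X) :
    AbsolutelyContinuousOnInterval (fun _ => c) a b :=
  ((LipschitzWith.const c).lipschitzOnWith (s := uIcc a b)).absolutelyContinuousOnInterval

lemma absolutelyContinuousOnInterval_integral {E : Type*} [NormedAddCommGroup E] [NormedSpace ℝ E]
    {h : ℝ → E} (hh : IntervalIntegrable h volume a b) :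
    AbsolutelyContinuousOnInterval (fun t => ∫ s in a..t, h s) a b := by
  have hsub {t : ℝ} (ht : t ∈ uIcc a b) : IntervalIntegrable h volume a t :=
    hh.mono_set (uIcc_subset_uIcc left_mem_uIcc ht)
  have hnorm := hh.norm.absolutelyContinuousOnInterval_intervalIntegral (c := a) left_mem_uIcc
  refine absolutelyContinuousOnInterval_of_dist_le (C := 1) (D := 0) hnorm hnorm
    fun s hs t ht => ?_
  rw [dist_eq_norm_sub, dist_eq_norm_sub,
    intervalIntegral.integral_interval_sub_left (hsub hs) (hsub ht),
    intervalIntegral.integral_interval_sub_left (hsub hs).norm (hsub ht).norm, one_mul, zero_mul,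
    add_zero]
  exact intervalIntegral.norm_integral_le_abs_integral_norm

lemma absolutelyContinuousOnInterval_inner {f g : ℝ → H}
    (hf : AbsolutelyContinuousOnInterval f a b) (hg : AbsolutelyContinuousOnInterval g a b) :
    AbsolutelyContinuousOnInterval (fun t => inner ℂ (f t) (g t)) a b := by
  obtain ⟨C, hC⟩ := hf.exists_bound
  obtain ⟨D, hD⟩ := hg.exists_bound
  refine absolutelyContinuousOnInterval_of_dist_le (C := D) (D := C) hf hg fun s hs t ht => ?_
  calc dist (inner ℂ (f s) (g s)) (inner ℂ (f t) (g t))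
      = ‖inner ℂ (f s - f t) (g s) + inner ℂ (f t) (g s - g t)‖ := by
        rw [dist_eq_norm_sub, inner_sub_left, inner_sub_right, sub_add_sub_cancel]
    _ ≤ ‖f s - f t‖ * ‖g s‖ + ‖f t‖ * ‖g s - g t‖ :=
        (norm_add_le _ _).trans (add_le_add (norm_inner_le_norm _ _) (norm_inner_le_norm _ _))
    _ ≤ D * dist (f s) (f t) + C * dist (g s) (g t) := by
        rw [← dist_eq_norm_sub, ← dist_eq_norm_sub, mul_comm (dist _ _)]
        gcongr
        exacts [hD s hs, hC t ht]

lemma integral_eq_sub_of_ae_hasDerivAt {E : Type*} [NormedAddCommGroup E] [NormedSpace ℝ E]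
    [CompleteSpace E] {f f' : ℝ → E} (hf : AbsolutelyContinuousOnInterval f a b)
    (hf' : IntervalIntegrable f' volume a b)
    (hderiv : ∀ᵐ t, t ∈ uIcc a b → HasDerivAt f (f' t) t) :
    ∫ t in a..b, f' t = f b - f a := by
  have hzero : ∀ᵐ t, t ∈ uIcc a b → HasDerivAt (f - fun t => ∫ s in a..t, f' s) 0 t := by
    filter_upwards [hderiv, hf'.ae_hasDerivAt_integral] with t h₁ h₂ ht
    simpa using (h₁ ht).sub (h₂ ht a left_mem_uIcc)
  obtain ⟨c, hc⟩ :=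
    (hf.sub (absolutelyContinuousOnInterval_integral hf')).const_of_ae_hasDerivAt_zero hzero
  have ha := hc a left_mem_uIcc
  have hb := hc b right_mem_uIcc
  simp only [Pi.sub_apply, intervalIntegral.integral_same, sub_zero] at ha hb
  rw [ha, ← hb, sub_sub_cancel]

lemma intervalIntegrable_inner {f h : ℝ → H} (hf : ContinuousOn f (uIcc a b))
    (hh : IntervalIntegrable h volume a b) :
    IntervalIntegrable (fun t => inner ℂ (f t) (h t)) volume a b := by
  obtain ⟨C, hC⟩ := isCompact_uIcc.exists_bound_of_continuousOn hf
  rw [intervalIntegrable_iff] at hh ⊢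
  refine (hh.norm.const_mul C).mono'
    (((hf.mono uIoc_subset_uIcc).aestronglyMeasurable measurableSet_uIoc).inner
      hh.aestronglyMeasurable) ?_
  filter_upwards [ae_restrict_mem measurableSet_uIoc] with t ht
  exact (norm_inner_le_norm _ _).trans
    (mul_le_mul_of_nonneg_right (hC t (uIoc_subset_uIcc ht)) (norm_nonneg _))

lemma integral_inner_deriv_add_deriv_inner {f f' g g' : ℝ → H}
    (hf : AbsolutelyContinuousOnInterval f a b) (hg : AbsolutelyContinuousOnInterval g a b)
    (hf' : ContinuousOn f' (uIcc a b)) (hg' : IntervalIntegrable g' volume a b)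
    (hfd : ∀ᵐ t, t ∈ uIcc a b → HasDerivAt f (f' t) t)
    (hgd : ∀ᵐ t, t ∈ uIcc a b → HasDerivAt g (g' t) t) :
    ∫ t in a..b, (inner ℂ (f t) (g' t) + inner ℂ (f' t) (g t))
      = inner ℂ (f b) (g b) - inner ℂ (f a) (g a) := by
  refine integral_eq_sub_of_ae_hasDerivAt (absolutelyContinuousOnInterval_inner hf hg) ?_ ?_
  · exact (intervalIntegrable_inner hf.continuousOn hg').add
      (hf'.inner hg.continuousOn).intervalIntegrable
  · filter_upwards [hfd, hgd] with t h₁ h₂ ht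
    exact (h₁ ht).inner ℂ (h₂ ht)

end AbsoluteContinuity

section MildSolution

open Filter Topology

variable {H : Type*} [NormedAddCommGroup H] [InnerProductSpace ℂ H]

/-- A test curve for the evolution equation `u' = Au` on `(0,T)`, where `A` is the operator with
graph `G`: a `C¹` curve `φ` in the domain of `A`, with derivative `φ'` and continuous image
`ψ = Aφ`, that vanishes at the final time. -/
structure IsTestCurve (G : Submodule ℂ (H × H)) (T : ℝ) (φ φ' ψ : ℝ → H) : Prop where
  hasDerivAt (t : ℝ) : HasDerivAt φ (φ' t) t
  continuous_deriv : Continuous φ'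
  continuous_image : Continuous ψ
  mem (t : ℝ) : (φ t, ψ t) ∈ G
  eq_zero : φ T = 0

namespace IsSkewAdjointGraph

variable [CompleteSpace H] {G : Submodule ℂ (H × H)} {x y : H} {T : ℝ}

lemma unitaryGroup_apply_neg_apply (hG : IsSkewAdjointGraph G) (t : ℝ) (x : H) :
    hG.unitaryGroup t (hG.unitaryGroup (-t) x) = x := by
  rw [← hG.unitaryGroup_add_apply, add_neg_cancel, hG.unitaryGroup_zero, one_apply_eq_self]

lemma inner_unitaryGroup_apply_apply (hG : IsSkewAdjointGraph G) (t : ℝ) (x y : H) :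
    inner ℂ (hG.unitaryGroup t x) (hG.unitaryGroup t y) = inner ℂ x y :=
  (LinearMap.norm_map_iff_inner_map_map _).1 (hG.norm_unitaryGroup_apply t) x y

lemma inner_unitaryGroup_apply_right (hG : IsSkewAdjointGraph G) (t : ℝ) (x y : H) :
    inner ℂ x (hG.unitaryGroup t y) = inner ℂ (hG.unitaryGroup (-t) x) y := by
  rw [← hG.inner_unitaryGroup_apply_apply t (hG.unitaryGroup (-t) x),
    hG.unitaryGroup_apply_neg_apply]

lemma continuous_unitaryGroup_uncurry (hG : IsSkewAdjointGraph G) :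
    Continuous fun p : H × ℝ => hG.unitaryGroup p.2 p.1 :=
  continuous_prod_of_continuous_lipschitzWith _ 1 hG.continuous_unitaryGroup_apply fun t =>
    AddMonoidHomClass.lipschitz_of_bound_nnnorm _ _ fun x =>
      (hG.norm_unitaryGroup_apply t x).le.trans_eq (one_mul _).symm

lemma hasDerivAt_unitaryGroup_neg_apply (hG : IsSkewAdjointGraph G) {φ : ℝ → H} {φ' ψ : H} {t : ℝ}
    (hφ : HasDerivAt φ φ' t) (hψ : (φ t, ψ) ∈ G) :
    HasDerivAt (fun s => hG.unitaryGroup (-s) (φ s)) (hG.unitaryGroup (-t) (φ' - ψ)) t := by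
  have hU : HasDerivAt (fun s => hG.unitaryGroup (-s) (φ t)) (-hG.unitaryGroup (-t) ψ) t := by
    simpa [Function.comp_def] using
      (hG.hasDerivAt_unitaryGroup_apply hψ (-t)).scomp t (hasDerivAt_neg t)
  rw [hasDerivAt_iff_tendsto_slope] at hφ hU ⊢
  have hneg : Tendsto (fun s : ℝ => -s) (𝓝[≠] t) (𝓝 (-t)) :=
    (continuous_neg.tendsto t).mono_left nhdsWithin_le_nhds
  have hlim := ((hG.continuous_unitaryGroup_uncurry.tendsto (φ', -t)).comp
    (hφ.prodMk_nhds hneg)).add hU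
  rw [map_sub, sub_eq_add_neg]
  refine hlim.congr fun s => ?_
  simp only [Function.comp_apply, slope, vsub_eq_sub, ContinuousLinearMap.map_smul_of_tower,
    map_sub]
  rw [← smul_add, sub_add_sub_cancel]

/-- The mild solution in the interaction picture: if `u' = Au + F`, then `v t = U (-t) (u t)`
satisfies `v' t = U (-t) (F t)`. -/
def interaction (hG : IsSkewAdjointGraph G) (u₀ : H) (F : ℝ → H) (t : ℝ) : H :=
  u₀ + ∫ s in (0 : ℝ)..t, hG.unitaryGroup (-s) (F s)

/-- The mild solution of `u' = Au + F`, `u 0 = u₀`. -/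
def mildSolution (hG : IsSkewAdjointGraph G) (u₀ : H) (F : ℝ → H) (t : ℝ) : H :=
  hG.unitaryGroup t (hG.interaction u₀ F t)

lemma mildSolution_zero (hG : IsSkewAdjointGraph G) (u₀ : H) (F : ℝ → H) :
    hG.mildSolution u₀ F 0 = u₀ := by
  simp [mildSolution, interaction, hG.unitaryGroup_zero]

lemma intervalIntegrable_unitaryGroup_neg_apply (hG : IsSkewAdjointGraph G) {F : ℝ → H} {a b : ℝ}
    (hF : IntervalIntegrable F volume a b) :
    IntervalIntegrable (fun s => hG.unitaryGroup (-s) (F s)) volume a b := by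
  rw [intervalIntegrable_iff] at hF ⊢
  refine Integrable.mono hF (hG.continuous_unitaryGroup_uncurry.comp_aestronglyMeasurable
    (hF.aestronglyMeasurable.prodMk continuous_neg.aestronglyMeasurable)) ?_
  exact .of_forall fun s => (hG.norm_unitaryGroup_apply _ _).le

variable {u₀ : H} {F : ℝ → H}

lemma absolutelyContinuousOnInterval_interaction (hG : IsSkewAdjointGraph G)
    (hF : IntervalIntegrable F volume 0 T) :
    AbsolutelyContinuousOnInterval (hG.interaction u₀ F) 0 T :=
  (absolutelyContinuousOnInterval_const u₀).add
    (absolutelyContinuousOnInterval_integral (hG.intervalIntegrable_unitaryGroup_neg_apply hF))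

lemma ae_hasDerivAt_interaction (hG : IsSkewAdjointGraph G)
    (hF : IntervalIntegrable F volume 0 T) :
    ∀ᵐ t, t ∈ uIcc 0 T → HasDerivAt (hG.interaction u₀ F) (hG.unitaryGroup (-t) (F t)) t := by
  filter_upwards [(hG.intervalIntegrable_unitaryGroup_neg_apply hF).ae_hasDerivAt_integral]
    with t h ht
  exact (h ht 0 left_mem_uIcc).const_add u₀

lemma continuousOn_mildSolution (hG : IsSkewAdjointGraph G)
    (hF : IntervalIntegrable F volume 0 T) : ContinuousOn (hG.mildSolution u₀ F) (uIcc 0 T) :=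
  hG.continuous_unitaryGroup_uncurry.comp_continuousOn
    ((hG.absolutelyContinuousOnInterval_interaction hF).continuousOn.prodMk continuousOn_id)

lemma norm_mildSolution (hG : IsSkewAdjointGraph G) (u₀ : H) (F : ℝ → H) (t : ℝ) :
    ‖hG.mildSolution u₀ F t‖ = ‖hG.interaction u₀ F t‖ :=
  hG.norm_unitaryGroup_apply _ _

lemma absolutelyContinuousOnInterval_norm_mildSolution_sq (hG : IsSkewAdjointGraph G)
    (hF : IntervalIntegrable F volume 0 T) :
    AbsolutelyContinuousOnInterval (fun t => 1 / 2 * ‖hG.mildSolution u₀ F t‖ ^ 2) 0 T := by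
  have hv := hG.absolutelyContinuousOnInterval_interaction (u₀ := u₀) hF
  refine AbsolutelyContinuousOnInterval.const_mul _ <| absolutelyContinuousOnInterval_of_dist_le
    (C := 1) (D := 0) (absolutelyContinuousOnInterval_inner hv hv) hv fun s _ t _ => ?_
  have hre (t : ℝ) : ‖hG.mildSolution u₀ F t‖ ^ 2
      = (inner ℂ (hG.interaction u₀ F t) (hG.interaction u₀ F t)).re := by
    rw [norm_mildSolution]
    exact norm_sq_eq_re_inner (𝕜 := ℂ) _
  rw [hre, hre, one_mul, zero_mul, add_zero, Real.dist_eq, ← Complex.sub_re, dist_eq_norm]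
  exact Complex.abs_re_le_norm _

lemma ae_hasDerivAt_norm_mildSolution_sq (hG : IsSkewAdjointGraph G)
    (hF : IntervalIntegrable F volume 0 T) :
    ∀ᵐ t, t ∈ uIcc 0 T → HasDerivAt (fun t => 1 / 2 * ‖hG.mildSolution u₀ F t‖ ^ 2)
      (inner ℂ (hG.mildSolution u₀ F t) (F t)).re t := by
  filter_upwards [hG.ae_hasDerivAt_interaction (u₀ := u₀) hF] with t h ht
  let _ : InnerProductSpace ℝ H := .rclikeToReal ℂ H
  have hpair : inner ℂ (hG.mildSolution u₀ F t) (F t)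
      = inner ℂ (hG.interaction u₀ F t) (hG.unitaryGroup (-t) (F t)) := by
    rw [inner_unitaryGroup_apply_right, neg_neg, mildSolution]
  simp only [norm_mildSolution, hpair]
  refine ((h ht).norm_sq.const_mul (1 / 2 : ℝ)).congr_deriv ?_
  rw [one_div, inv_mul_cancel_left₀ two_ne_zero]
  rfl

lemma integral_inner_mildSolution (hG : IsSkewAdjointGraph G)
    (hF : IntervalIntegrable F volume 0 T) {φ φ' ψ : ℝ → H} (hφ : IsTestCurve G T φ φ' ψ) :
    ∫ t in (0 : ℝ)..T, inner ℂ (ψ t - φ' t) (hG.mildSolution u₀ F t)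
      = (∫ t in (0 : ℝ)..T, inner ℂ (φ t) (F t)) + inner ℂ (φ 0) u₀ := by
  have hφc : Continuous φ := continuous_iff_continuousAt.2 fun t => (hφ.hasDerivAt t).continuousAt
  have hχ (t : ℝ) := hG.hasDerivAt_unitaryGroup_neg_apply (hφ.hasDerivAt t) (hφ.mem t)
  have hχ' : Continuous fun t => hG.unitaryGroup (-t) (φ' t - ψ t) :=
    hG.continuous_unitaryGroup_uncurry.comp
      ((hφ.continuous_deriv.sub hφ.continuous_image).prodMk continuous_neg)
  have hχa : AbsolutelyContinuousOnInterval (fun t => hG.unitaryGroup (-t) (φ t)) 0 T :=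
    ContDiffOn.absolutelyContinuousOnInterval <| ContDiff.contDiffOn <| contDiff_one_iff_deriv.2
      ⟨fun t => (hχ t).differentiableAt, by rwa [funext fun t => (hχ t).deriv]⟩
  have hv := hG.absolutelyContinuousOnInterval_interaction (u₀ := u₀) hF
  have hF' := hG.intervalIntegrable_unitaryGroup_neg_apply hF
  have hparts := integral_inner_deriv_add_deriv_inner hχa hv hχ'.continuousOn hF'
    (.of_forall fun t _ => hχ t) (hG.ae_hasDerivAt_interaction hF)
  have hχv (t : ℝ) : inner ℂ (hG.unitaryGroup (-t) (φ' t - ψ t)) (hG.interaction u₀ F t)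
      = -inner ℂ (ψ t - φ' t) (hG.mildSolution u₀ F t) := by
    rw [← inner_unitaryGroup_apply_right, ← inner_neg_left, neg_sub, mildSolution]
  have hsol : IntervalIntegrable (fun t => inner ℂ (ψ t - φ' t) (hG.mildSolution u₀ F t))
      volume 0 T :=
    ((hφ.continuous_image.sub hφ.continuous_deriv).continuousOn.inner
      (hG.continuousOn_mildSolution hF)).intervalIntegrable
  have hφF := intervalIntegrable_inner hφc.continuousOn hF
  simp only [hχv, inner_unitaryGroup_apply_apply, hφ.eq_zero, map_zero, inner_zero_left, zero_sub,
    neg_zero, hG.unitaryGroup_zero, one_apply_eq_self] at hparts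
  simp only [← sub_eq_add_neg] at hparts
  have h₀ : hG.interaction u₀ F 0 = u₀ := by simp [interaction]
  rw [h₀, intervalIntegral.integral_sub hφF hsol] at hparts
  linear_combination -hparts

end IsSkewAdjointGraph

end MildSolution

section Uniqueness

variable {H : Type*} [NormedAddCommGroup H]

lemma integrableOn_smul [NormedSpace ℝ H] {η : ℝ → ℝ} {v : ℝ → H} {s : Set ℝ} (hη : Continuous η)
    (hc : HasCompactSupport η) (hv : IntegrableOn v s) : IntegrableOn (fun t => η t • v t) s :=
  hv.integrable.locallyIntegrable.integrable_smul_left_of_hasCompactSupport hη hc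

lemma hasDerivAt_integral_translate_smul [NormedSpace ℝ H] {μ : Measure ℝ} {η : ℝ → ℝ} {w : ℝ → H}
    (hη : ContDiff ℝ 1 η) (hc : HasCompactSupport η) (hw : Integrable w μ) (τ : ℝ) :
    HasDerivAt (fun τ => ∫ s, η (s + τ) • w s ∂μ) (∫ s, deriv η (s + τ) • w s ∂μ) τ := by
  have hη' : Continuous (deriv η) := hη.continuous_deriv_one
  obtain ⟨C, hC⟩ := hη'.bounded_above_of_compact_support hc.deriv
  obtain ⟨D, hD⟩ := hη.continuous.bounded_above_of_compact_support hc
  have hmeas {a : ℝ → ℝ} (ha : Continuous a) (τ : ℝ) :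
      AEStronglyMeasurable (fun s => a (s + τ) • w s) μ :=
    (ha.comp (continuous_add_const τ)).aestronglyMeasurable.smul hw.aestronglyMeasurable
  refine (hasDerivAt_integral_of_dominated_loc_of_deriv_le (F' := fun τ s => deriv η (s + τ) • w s)
    (bound := fun s => C * ‖w s‖)
    Filter.univ_mem (.of_forall (hmeas hη.continuous)) ?_ (hmeas hη' τ) ?_
    (hw.norm.const_mul C) ?_).2
  · exact hw.bdd_smul D (hη.continuous.comp (continuous_add_const τ)).aestronglyMeasurable
      (.of_forall fun s => hD _)
  · refine .of_forall fun s τ _ => ?_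
    rw [norm_smul]
    exact mul_le_mul_of_nonneg_right (hC _) (norm_nonneg _)
  · refine .of_forall fun s τ _ => ?_
    have := ((hη.differentiable one_ne_zero) (s + τ)).hasDerivAt.comp_const_add s τ
    exact this.smul_const (w s)

namespace IsSkewAdjointGraph

variable [InnerProductSpace ℂ H] {G : Submodule ℂ (H × H)} {T : ℝ}

lemma norm_eq_of_hasDerivAt (hG : IsSkewAdjointGraph G) {W W' : ℝ → H} {a b : ℝ}
    (hab : a ≤ b) (hW : ∀ t ∈ Icc a b, HasDerivAt W (W' t) t)
    (hmem : ∀ t ∈ Icc a b, (W t, -W' t) ∈ G) : ‖W a‖ = ‖W b‖ := by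
  let _ : InnerProductSpace ℝ H := .rclikeToReal ℂ H
  have hderiv (t : ℝ) (ht : t ∈ Icc a b) : HasDerivAt (fun t => ‖W t‖ ^ 2) 0 t := by
    have h₀ := hG.re_inner_eq_zero (hmem t ht)
    rw [inner_neg_right, Complex.neg_re, neg_eq_zero] at h₀
    refine (hW t ht).norm_sq.congr_deriv ?_
    exact mul_eq_zero_of_right 2 h₀
  have hsq : ‖W b‖ ^ 2 = ‖W a‖ ^ 2 :=
    constant_of_has_deriv_right_zero (fun t ht => (hderiv t ht).continuousAt.continuousWithinAt)
      (fun t ht => (hderiv t (Ico_subset_Icc_self ht)).hasDerivWithinAt) b (right_mem_Icc.2 hab)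
  exact ((sq_eq_sq₀ (norm_nonneg _) (norm_nonneg _)).1 hsq).symm

/- Sliding the test function out of `(0,T)` gives a curve that solves `W' = -AW`: its norm is
constant and it vanishes at the end. -/
lemma integral_smul_eq_zero (hG : IsSkewAdjointGraph G) (hT : 0 ≤ T) {w : ℝ → H}
    (hw : IntegrableOn w (Ioo 0 T))
    (hmem : ∀ η : ℝ → ℝ, ContDiff ℝ ∞ η → HasCompactSupport η → tsupport η ⊆ Iio T →
      (∫ t in Ioo 0 T, η t • w t, -∫ t in Ioo 0 T, deriv η t • w t) ∈ G)
    {η : ℝ → ℝ} (hη : ContDiff ℝ ∞ η) (hc : HasCompactSupport η) (hηT : tsupport η ⊆ Iio T) :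
    ∫ t in Ioo 0 T, η t • w t = 0 := by
  set W : ℝ → H := fun τ => ∫ s in Ioo 0 T, η (s + τ) • w s with hW
  have htranslate (τ : ℝ) (hτ : τ ∈ Icc 0 T) :
      (W τ, -∫ s in Ioo 0 T, deriv η (s + τ) • w s) ∈ G := by
    have hsupp : tsupport (fun s => η (s + τ)) = (· + τ) ⁻¹' tsupport η :=
      tsupport_comp_eq_preimage η (Homeomorph.addRight τ)
    convert hmem (fun s => η (s + τ)) (hη.comp (contDiff_id.add contDiff_const))
      (hc.comp_homeomorph (Homeomorph.addRight τ)) ?_ using 5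
    · rw [deriv_comp_add_const]
    · exact hsupp.trans_subset fun s hs => (le_add_of_nonneg_right hτ.1).trans_lt (hηT hs)
  have hnorm : ‖W 0‖ = ‖W T‖ := hG.norm_eq_of_hasDerivAt hT
    (fun τ _ => hasDerivAt_integral_translate_smul (hη.of_le (by simp)) hc hw τ) htranslate
  have hend : W T = 0 := setIntegral_eq_zero_of_forall_eq_zero fun s hs => by
    have hs' : s + T ∉ tsupport η := fun h => (hηT h).not_ge (le_add_of_nonneg_left hs.1.le)
    rw [image_eq_zero_of_notMem_tsupport hs', zero_smul]
  rw [hend, norm_zero, norm_eq_zero] at hnorm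
  simpa [hW] using hnorm

lemma ae_eq_zero (hG : IsSkewAdjointGraph G) [CompleteSpace H] {w : ℝ → H}
    (hw : IntegrableOn w (Ioo 0 T))
    (hmem : ∀ η : ℝ → ℝ, ContDiff ℝ ∞ η → HasCompactSupport η → tsupport η ⊆ Iio T →
      (∫ t in Ioo 0 T, η t • w t, -∫ t in Ioo 0 T, deriv η t • w t) ∈ G) :
    ∀ᵐ t, t ∈ Ioo 0 T → w t = 0 := by
  rcases lt_or_ge T 0 with hT | hT
  · exact .of_forall fun t ht => absurd (ht.1.trans ht.2) hT.not_gt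
  refine isOpen_Ioo.ae_eq_zero_of_integral_contDiff_smul_eq_zero hw.locallyIntegrableOn
    fun η hη hc hsupp => ?_
  rw [← setIntegral_eq_integral_of_forall_compl_eq_zero (s := Ioo 0 T) fun t ht => by
    rw [image_eq_zero_of_notMem_tsupport fun h => ht (hsupp h), zero_smul]]
  exact hG.integral_smul_eq_zero hT hw hmem hη hc (hsupp.trans Ioo_subset_Iio_self)

end IsSkewAdjointGraph

end Uniqueness

section MaxwellGraph

variable {X : Type*} [NormedAddCommGroup X] [InnerProductSpace ℂ X]

/-- `p` is an invertible symmetric square root of the operator `P`. -/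
structure IsSqrt (p : X ≃L[ℂ] X) (P : X →L[ℂ] X) : Prop where
  inner_left (x y : X) : inner ℂ (p x) y = inner ℂ x (p y)
  apply_apply (x : X) : p (p x) = P x

lemma exists_isSqrt [CompleteSpace X] {P : X →L[ℂ] X} (hP : IsStrictlyPositive P) :
    ∃ p, IsSqrt p P := by
  have hsa : IsSelfAdjoint (CFC.sqrt P) := (CFC.sqrt_nonneg P).isSelfAdjoint
  obtain ⟨p, hp⟩ := (CFC.isUnit_sqrt_iff P hP.nonneg).2 hP.isUnit
  refine ⟨.ofUnit p, ⟨fun x y => ?_, fun x => ?_⟩⟩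
  · change inner ℂ (p.1 x) y = inner ℂ x (p.1 y)
    rw [hp]
    exact hsa.isSymmetric x y
  · change (p.1 * p.1) x = P x
    rw [hp, CFC.sqrt_mul_sqrt_self P hP.nonneg]

namespace IsSqrt

variable {p : X ≃L[ℂ] X} {P : X →L[ℂ] X}

lemma inner_symm_left (hp : IsSqrt p P) (x y : X) :
    inner ℂ (p.symm x) y = inner ℂ x (p.symm y) := by
  rw [← p.apply_symm_apply y, ← hp.inner_left, p.apply_symm_apply, p.symm_apply_apply]

lemma inner_symm_apply (hp : IsSqrt p P) (x y : X) : inner ℂ (p.symm x) (p y) = inner ℂ x y := by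
  rw [hp.inner_symm_left, p.symm_apply_apply]

lemma inner_apply_symm (hp : IsSqrt p P) (x y : X) : inner ℂ (p x) (p.symm y) = inner ℂ x y := by
  rw [hp.inner_left, p.apply_symm_apply]

lemma inner_apply_apply (hp : IsSqrt p P) (x y : X) : inner ℂ (p x) (p y) = inner ℂ x (P y) := by
  rw [hp.inner_left, hp.apply_apply]

lemma norm_apply_sq (hp : IsSqrt p P) (x : X) : ‖p x‖ ^ 2 = (inner ℂ x (P x)).re := by
  rw [← hp.inner_apply_apply]
  exact norm_sq_eq_re_inner (𝕜 := ℂ) _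

end IsSqrt

/-- `C` is the graph of a self-adjoint operator; as in `IsSkewAdjointGraph`, the second condition
amounts to the density of its domain. -/
structure IsSelfAdjointGraph (C : Submodule ℂ (X × X)) : Prop where
  mem_iff (p : X × X) : p ∈ C ↔ ∀ q ∈ C, inner ℂ q.2 p.1 = inner ℂ q.1 p.2
  eq_zero_of_zero_mem {y : X} : (0, y) ∈ C → y = 0

/-- The graph of the Maxwell operator `(e, b) ↦ (p⁻¹ C r b, -r C p⁻¹ e)`, where `p² = P`,
`r² = Q⁻¹` and `C` stands for the curl. In the unknowns `e = p E` and `b = r⁻¹ Q⁻¹ B = r B`,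
for which the energy is `(‖e‖² + ‖b‖²) / 2`, the system takes the form `u' = Au + (p⁻¹ g, r f)`. -/
def maxwellGraph (C : Submodule ℂ (X × X)) (p r : X ≃L[ℂ] X) :
    Submodule ℂ (WithLp 2 (X × X) × WithLp 2 (X × X)) where
  carrier := {z | (r z.1.snd, p z.2.fst) ∈ C ∧ (p.symm z.1.fst, -r.symm z.2.snd) ∈ C}
  add_mem' hz hz' := by
    refine ⟨?_, ?_⟩
    · simpa using C.add_mem hz.1 hz'.1
    · simpa [add_comm] using C.add_mem hz.2 hz'.2
  zero_mem' := by
    constructor <;> simp [← Prod.zero_eq_mk]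
  smul_mem' c z hz := by
    refine ⟨?_, ?_⟩
    · simpa using C.smul_mem c hz.1
    · simpa using C.smul_mem c hz.2

variable {C : Submodule ℂ (X × X)} {p r : X ≃L[ℂ] X} {P R : X →L[ℂ] X}

lemma mem_maxwellGraph {z : WithLp 2 (X × X) × WithLp 2 (X × X)} :
    z ∈ maxwellGraph C p r ↔
      (r z.1.snd, p z.2.fst) ∈ C ∧ (p.symm z.1.fst, -r.symm z.2.snd) ∈ C :=
  Iff.rfl

lemma electric_mem_maxwellGraph {x y : X} (h : (x, y) ∈ C) :
    (WithLp.toLp 2 (p x, 0), WithLp.toLp 2 (0, -r y)) ∈ maxwellGraph C p r := by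
  simpa [mem_maxwellGraph, ← Prod.zero_eq_mk] using h

lemma magnetic_mem_maxwellGraph {x y : X} (h : (x, y) ∈ C) :
    (WithLp.toLp 2 (0, r.symm x), WithLp.toLp 2 (p.symm y, 0)) ∈ maxwellGraph C p r := by
  simpa [mem_maxwellGraph, ← Prod.zero_eq_mk] using h

lemma isSkewAdjointGraph_maxwellGraph (hC : IsSelfAdjointGraph C) (hp : IsSqrt p P)
    (hr : IsSqrt r R) : IsSkewAdjointGraph (maxwellGraph C p r) where
  mem_iff z := by
    refine ⟨fun hz q hq => ?_, fun h => ⟨(hC.mem_iff _).2 fun q hq => ?_,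
      (hC.mem_iff _).2 fun q hq => ?_⟩⟩
    · have h₁ := (hC.mem_iff _).1 hz.2 _ hq.1
      have h₂ := (hC.mem_iff _).1 hz.1 _ hq.2
      simp only [inner_neg_left, inner_neg_right, hp.inner_apply_symm, hr.inner_apply_symm,
        hp.inner_symm_apply, hr.inner_symm_apply] at h₁ h₂
      simp only [WithLp.prod_inner_apply, WithLp.ofLp_fst, WithLp.ofLp_snd]
      linear_combination h₁ - h₂
    · have h₀ := h _ (electric_mem_maxwellGraph hq)
      simp only [WithLp.prod_inner_apply, WithLp.ofLp_fst, WithLp.ofLp_snd, inner_zero_left,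
        inner_neg_left, hp.inner_left, hr.inner_left] at h₀
      linear_combination -h₀
    · have h₀ := h _ (magnetic_mem_maxwellGraph hq)
      simp only [WithLp.prod_inner_apply, WithLp.ofLp_fst, WithLp.ofLp_snd, inner_zero_left,
        hp.inner_symm_left, hr.inner_symm_left] at h₀
      rw [inner_neg_right]
      linear_combination h₀
  eq_zero_of_zero_mem {y} h := by
    have h₁ : y.fst = 0 := by
      simpa using hC.eq_zero_of_zero_mem (y := p y.fst) (by simpa using h.1)
    have h₂ : y.snd = 0 := by
      simpa using hC.eq_zero_of_zero_mem (y := -r.symm y.snd) (by simpa using h.2)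
    exact WithLp.ofLp_injective 2 (Prod.ext h₁ h₂)

/-- The state `(p E, r B)` of the system with the fields `E` and `B`. -/
def maxwellState (p r : X ≃L[ℂ] X) : X × X →L[ℂ] WithLp 2 (X × X) :=
  (WithLp.prodContinuousLinearEquiv 2 ℂ X X).symm ∘L (p : X →L[ℂ] X).prodMap (r : X →L[ℂ] X)

@[simp]
lemma maxwellState_apply (z : X × X) : maxwellState p r z = WithLp.toLp 2 (p z.1, r z.2) :=
  rfl

lemma electric_magnetic_ae_eq_zero [CompleteSpace X] (hC : IsSelfAdjointGraph C) (hp : IsSqrt p P)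
    (hr : IsSqrt r R) {T : ℝ} {E B : ℝ → X} (hE : IntegrableOn E (Ioo 0 T))
    (hB : IntegrableOn B (Ioo 0 T))
    (faraday : ∀ η : ℝ → ℝ, ContDiff ℝ ∞ η → HasCompactSupport η → tsupport η ⊆ Iio T →
      (∫ t in Ioo 0 T, η t • E t, ∫ t in Ioo 0 T, deriv η t • B t) ∈ C)
    (ampere : ∀ η : ℝ → ℝ, ContDiff ℝ ∞ η → HasCompactSupport η → tsupport η ⊆ Iio T →
      (R (∫ t in Ioo 0 T, η t • B t), -P (∫ t in Ioo 0 T, deriv η t • E t)) ∈ C) :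
    ∀ᵐ t, t ∈ Ioo 0 T → E t = 0 ∧ B t = 0 := by
  have hG := isSkewAdjointGraph_maxwellGraph hC hp hr
  have hEB : IntegrableOn (fun t => (E t, B t)) (Ioo 0 T) := hE.prodMk hB
  have hL {η : ℝ → ℝ} (hη : Continuous η) (hc : HasCompactSupport η) :
      ∫ t in Ioo 0 T, η t • maxwellState p r (E t, B t)
        = maxwellState p r (∫ t in Ioo 0 T, η t • E t, ∫ t in Ioo 0 T, η t • B t) := by
    have hE' := integrableOn_smul hη hc hE
    have hB' := integrableOn_smul hη hc hB
    rw [← integral_pair hE' hB', ← ContinuousLinearMap.integral_comp_comm _ (hE'.prodMk hB')]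
    simp only [← Prod.smul_mk, ContinuousLinearMap.map_smul_of_tower]
  have hw : IntegrableOn (fun t => maxwellState p r (E t, B t)) (Ioo 0 T) :=
    (maxwellState p r).integrable_comp hEB
  have h₀ := hG.ae_eq_zero hw fun η hη hc hT => by
    rw [hL hη.continuous hc, hL (hη.continuous_deriv (by simp)) hc.deriv]
    refine mem_maxwellGraph.2 ⟨?_, ?_⟩
    · simpa [hp.apply_apply, hr.apply_apply] using ampere η hη hc hT
    · simpa using faraday η hη hc hT
  filter_upwards [h₀] with t h ht
  simpa using h ht

end MaxwellGraph

section MaxwellSolution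

lemma IsTestCurve.map {X Y : Type*} [NormedAddCommGroup X] [InnerProductSpace ℂ X]
    [NormedAddCommGroup Y] [InnerProductSpace ℂ Y] {G : Submodule ℂ (X × X)}
    {G' : Submodule ℂ (Y × Y)} {T : ℝ} {φ φ' ψ : ℝ → X} (h : IsTestCurve G T φ φ' ψ)
    (L M : X →L[ℂ] Y) (hLM : ∀ x y, (x, y) ∈ G → (L x, M y) ∈ G') :
    IsTestCurve G' T (fun t => L (φ t)) (fun t => L (φ' t)) (fun t => M (ψ t)) where
  hasDerivAt t := (L.restrictScalars ℝ).hasFDerivAt.comp_hasDerivAt t (h.hasDerivAt t)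
  continuous_deriv := L.continuous.comp h.continuous_deriv
  continuous_image := M.continuous.comp h.continuous_image
  mem t := hLM _ _ (h.mem t)
  eq_zero := by rw [h.eq_zero, map_zero]

variable {X : Type*} [NormedAddCommGroup X] [InnerProductSpace ℂ X]
  {C : Submodule ℂ (X × X)} {p r : X ≃L[ℂ] X} {P R : X →L[ℂ] X} {T : ℝ}

lemma intervalIntegrable_maxwellState {f g : ℝ → X} (hg : IntervalIntegrable g volume 0 T)
    (hf : IntervalIntegrable f volume 0 T) :
    IntervalIntegrable (fun s => maxwellState p r (g s, f s)) volume 0 T := by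
  rw [intervalIntegrable_iff] at hf hg ⊢
  exact (maxwellState p r).integrable_comp (hg.prodMk hf)

lemma norm_maxwellState_sq (hp : IsSqrt p P) (hr : IsSqrt r R) (z : X × X) :
    ‖maxwellState p r z‖ ^ 2 = (inner ℂ z.2 (R z.2) + inner ℂ z.1 (P z.1)).re := by
  rw [maxwellState_apply, WithLp.prod_norm_sq_eq_of_L2, Complex.add_re, ← hp.norm_apply_sq,
    ← hr.norm_apply_sq, add_comm]
  rfl

lemma inner_maxwellState_symm (hp : IsSqrt p P) (hr : IsSqrt r R) (z w : X × X) :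
    inner ℂ (maxwellState p r z) (maxwellState p.symm r w)
      = inner ℂ z.2 (R w.2) + inner ℂ z.1 w.1 := by
  simp only [maxwellState_apply, WithLp.prod_inner_apply, hp.inner_apply_symm, hr.inner_apply_apply]
  exact add_comm _ _

namespace IsSkewAdjointGraph

variable [CompleteSpace X] (hG : IsSkewAdjointGraph (maxwellGraph C p r)) (E₀ B₀ : X) (f g : ℝ → X)

/-- The fields `(E, B)` of the mild solution of the Maxwell system with initial fields `E₀, B₀`
and sources `f, g`. -/
def mildFields (t : ℝ) : X × X :=
  (p.symm.prodCongr r.symm) <| WithLp.ofLp <|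
    hG.mildSolution (maxwellState p r (E₀, B₀)) (fun s => maxwellState p.symm r (g s, f s)) t

lemma maxwellState_mildFields (t : ℝ) :
    maxwellState p r (hG.mildFields E₀ B₀ f g t)
      = hG.mildSolution (maxwellState p r (E₀, B₀))
        (fun s => maxwellState p.symm r (g s, f s)) t :=
  WithLp.ofLp_injective 2 ((p.prodCongr r).apply_symm_apply _)

lemma mildFields_zero : hG.mildFields E₀ B₀ f g 0 = (E₀, B₀) := by
  simp [mildFields, mildSolution_zero]

variable {f g}

lemma continuousOn_mildFields (hf : IntervalIntegrable f volume 0 T)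
    (hg : IntervalIntegrable g volume 0 T) :
    ContinuousOn (hG.mildFields E₀ B₀ f g) (uIcc 0 T) :=
  ((p.symm.prodCongr r.symm).continuous.comp
    (WithLp.prod_continuous_ofLp 2 X X)).comp_continuousOn
    (hG.continuousOn_mildSolution (intervalIntegrable_maxwellState hg hf))

lemma faraday_mildFields (hp : IsSqrt p P) (hr : IsSqrt r R) (hf : IntervalIntegrable f volume 0 T)
    (hg : IntervalIntegrable g volume 0 T) {φ φ' ψ : ℝ → X} (hφ : IsTestCurve C T φ φ' ψ) :
    ∫ t in (0 : ℝ)..T, (-inner ℂ (φ' t) (hG.mildFields E₀ B₀ f g t).2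
        + inner ℂ (ψ t) (hG.mildFields E₀ B₀ f g t).1)
      = (∫ t in (0 : ℝ)..T, inner ℂ (φ t) (f t)) + inner ℂ (φ 0) B₀ := by
  have h := hG.integral_inner_mildSolution (u₀ := maxwellState p r (E₀, B₀))
    (intervalIntegrable_maxwellState (p := p.symm) (r := r) hg hf)
    (hφ.map (maxwellState p.symm r.symm ∘L .inr ℂ X X)
      (maxwellState p.symm r.symm ∘L .inl ℂ X X) fun x y h => by
        simpa using magnetic_mem_maxwellGraph h)
  simp only [← maxwellState_mildFields] at h
  simpa [sub_eq_add_neg, hp.inner_symm_apply, hr.inner_symm_apply, add_comm] using h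

lemma ampere_mildFields (hp : IsSqrt p P) (hr : IsSqrt r R) (hf : IntervalIntegrable f volume 0 T)
    (hg : IntervalIntegrable g volume 0 T) {φ φ' ψ : ℝ → X} (hφ : IsTestCurve C T φ φ' ψ) :
    ∫ t in (0 : ℝ)..T, (-inner ℂ (φ' t) (P (hG.mildFields E₀ B₀ f g t).1)
        - inner ℂ (ψ t) (R (hG.mildFields E₀ B₀ f g t).2))
      = (∫ t in (0 : ℝ)..T, inner ℂ (φ t) (g t)) + inner ℂ (φ 0) (P E₀) := by
  have h := hG.integral_inner_mildSolution (u₀ := maxwellState p r (E₀, B₀))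
    (intervalIntegrable_maxwellState (p := p.symm) (r := r) hg hf)
    (hφ.map (maxwellState p r ∘L .inl ℂ X X) (maxwellState p r ∘L (-.inr ℂ X X)) fun x y h => by
      simpa [← WithLp.toLp_neg] using electric_mem_maxwellGraph (p := p) (r := r) h)
  simp only [← maxwellState_mildFields] at h
  simpa [sub_eq_add_neg, hp.inner_apply_symm, hp.inner_apply_apply, hr.inner_apply_apply,
    add_comm] using h

lemma absolutelyContinuousOnInterval_energy_mildFields (hp : IsSqrt p P) (hr : IsSqrt r R)
    (hf : IntervalIntegrable f volume 0 T) (hg : IntervalIntegrable g volume 0 T) :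
    AbsolutelyContinuousOnInterval (fun t => 1 / 2 * (inner ℂ (hG.mildFields E₀ B₀ f g t).2
      (R (hG.mildFields E₀ B₀ f g t).2) + inner ℂ (hG.mildFields E₀ B₀ f g t).1
      (P (hG.mildFields E₀ B₀ f g t).1)).re) 0 T := by
  have h := hG.absolutelyContinuousOnInterval_norm_mildSolution_sq
    (u₀ := maxwellState p r (E₀, B₀)) (intervalIntegrable_maxwellState (p := p.symm) (r := r) hg hf)
  simp only [← maxwellState_mildFields, norm_maxwellState_sq hp hr] at h
  exact h

lemma ae_hasDerivAt_energy_mildFields (hp : IsSqrt p P) (hr : IsSqrt r R)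
    (hf : IntervalIntegrable f volume 0 T) (hg : IntervalIntegrable g volume 0 T) :
    ∀ᵐ t, t ∈ uIcc 0 T → HasDerivAt (fun t => 1 / 2 * (inner ℂ (hG.mildFields E₀ B₀ f g t).2
      (R (hG.mildFields E₀ B₀ f g t).2) + inner ℂ (hG.mildFields E₀ B₀ f g t).1
      (P (hG.mildFields E₀ B₀ f g t).1)).re)
      (inner ℂ (hG.mildFields E₀ B₀ f g t).2 (R (f t))
        + inner ℂ (hG.mildFields E₀ B₀ f g t).1 (g t)).re t := by
  have h := hG.ae_hasDerivAt_norm_mildSolution_sq (u₀ := maxwellState p r (E₀, B₀))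
    (intervalIntegrable_maxwellState (p := p.symm) (r := r) hg hf)
  simp only [← maxwellState_mildFields, norm_maxwellState_sq hp hr,
    inner_maxwellState_symm hp hr] at h
  exact h

end IsSkewAdjointGraph

end MaxwellSolution

section MultiplicationOperators

variable {H : Type*} [NormedAddCommGroup H] [InnerProductSpace ℂ H] [CompleteSpace H]

lemma isStrictlyPositive_of_coercive {M : H →L[ℂ] H} (hM : IsSelfAdjoint M) {c : ℝ} (hc : 0 < c)
    (hcoer : ∀ u, c * ‖u‖ ^ 2 ≤ (inner ℂ u (M u)).re) : IsStrictlyPositive M := by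
  have hunit : IsUnit M := by
    refine M.isUnit_of_forall_le_norm_inner_map (c := ⟨c, hc.le⟩) hc fun u => ?_
    rw [mul_comm, norm_inner_symm]
    exact (hcoer u).trans (Complex.re_le_norm _)
  refine hunit.isStrictlyPositive ((M.nonneg_iff_isPositive).2 ?_)
  refine M.isPositive_def'.2 ⟨hM, fun u => ?_⟩
  rw [M.reApplyInnerSelf_apply, inner_re_symm]
  exact (by positivity : (0 : ℝ) ≤ c * ‖u‖ ^ 2).trans (hcoer u)

-- The functional calculus instance behind this lemma is not found when `H` is an `Lp` space.
lemma isStrictlyPositive_ringInverse {M : H →L[ℂ] H} (hM : IsStrictlyPositive M) :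
    IsStrictlyPositive (Ring.inverse M) :=
  hM.ringInverse

variable {Ω : Type*} [MeasurableSpace Ω] {μ : Measure Ω}
variable {V : Type*} [NormedAddCommGroup V] [InnerProductSpace ℂ V]
variable {M : Lp V 2 μ →L[ℂ] Lp V 2 μ} {a : Ω → V →L[ℂ] V}

/-- `M` is the operator of pointwise application of the operator field `a` on `L²(μ; V)`. -/
def IsMulOp (M : Lp V 2 μ →L[ℂ] Lp V 2 μ) (a : Ω → V →L[ℂ] V) : Prop :=
  ∀ u, M u =ᵐ[μ] fun x => a x (u x)

lemma exists_isMulOp (ha : MemLp a ∞ μ) : ∃ M : Lp V 2 μ →L[ℂ] Lp V 2 μ, IsMulOp M a := by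
  refine ⟨(ContinuousLinearMap.id ℂ (V →L[ℂ] V)).holderL μ ∞ 2 2 (ha.toLp a), fun u => ?_⟩
  have hcoe := (ContinuousLinearMap.id ℂ (V →L[ℂ] V)).coeFn_holder (r := 2) (ha.toLp a) u
  filter_upwards [hcoe, ha.coeFn_toLp] with x hx hax
  exact hx.trans (by rw [hax]; rfl)

namespace IsMulOp

lemma inner_ae (hM : IsMulOp M a) (u v : Lp V 2 μ) :
    (fun x => inner ℂ (u x) (M v x)) =ᵐ[μ] fun x => inner ℂ (u x) (a x (v x)) :=
  (hM v).mono fun x hx => by simp only [hx]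

lemma inner_right (hM : IsMulOp M a) (u v : Lp V 2 μ) :
    inner ℂ u (M v) = ∫ x, inner ℂ (u x) (a x (v x)) ∂μ :=
  (L2.inner_def u (M v)).trans (integral_congr_ae (hM.inner_ae u v))

lemma integrable_inner (hM : IsMulOp M a) (u v : Lp V 2 μ) :
    Integrable (fun x => inner ℂ (u x) (a x (v x))) μ :=
  (L2.integrable_inner u (M v)).congr (hM.inner_ae u v)

lemma ringInverse (hM : IsMulOp M a) (hunit : IsUnit M) {b : Ω → V →L[ℂ] V}
    (hba : ∀ᵐ x ∂μ, b x * a x = 1) : IsMulOp (Ring.inverse M) b := fun u => by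
  have hu : M (Ring.inverse M u) = u := congrArg (· u) (Ring.mul_inverse_cancel M hunit)
  filter_upwards [hM (Ring.inverse M u), hba] with x hx hbax
  rw [hu] at hx
  rw [hx]
  exact (congrArg (· (Ring.inverse M u x)) hbax).symm

variable [CompleteSpace V]

lemma isSelfAdjoint (hM : IsMulOp M a) (ha : ∀ᵐ x ∂μ, IsSelfAdjoint (a x)) :
    IsSelfAdjoint M := by
  refine ContinuousLinearMap.isSelfAdjoint_iff_isSymmetric.2 fun u v => ?_
  rw [ContinuousLinearMap.coe_coe, hM.inner_right, ← inner_conj_symm, hM.inner_right,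
    ← integral_conj]
  refine integral_congr_ae (ha.mono fun x hx => ?_)
  simp only [inner_conj_symm]
  exact hx.isSymmetric _ _

lemma isStrictlyPositive (hM : IsMulOp M a) (ha : ∀ᵐ x ∂μ, IsSelfAdjoint (a x)) {c : ℝ}
    (hc : 0 < c) (hcoer : ∀ᵐ x ∂μ, ∀ ξ, c * ‖ξ‖ ^ 2 ≤ (inner ℂ ξ (a x ξ)).re) :
    IsStrictlyPositive M := by
  refine isStrictlyPositive_of_coercive (hM.isSelfAdjoint ha) hc fun u => ?_
  have hnorm : c * ‖u‖ ^ 2 = ∫ x, c * ‖u x‖ ^ 2 ∂μ := by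
    rw [integral_const_mul, ← inner_self_eq_norm_sq (𝕜 := ℂ), L2.inner_def]
    refine congrArg _ ((integral_re (L2.integrable_inner u u)).symm.trans ?_)
    simp only [inner_self_eq_norm_sq]
  rw [hM.inner_right, hnorm]
  refine le_of_le_of_eq ?_ (integral_re (hM.integrable_inner u u))
  exact integral_mono_ae ((Lp.memLp u).integrable_norm_pow two_ne_zero |>.const_mul c)
    (hM.integrable_inner u u).re (hcoer.mono fun x hx => hx (u x))

end IsMulOp

end MultiplicationOperators

section Coefficients

variable {A P Q : R3 → Matrix (Fin 3) (Fin 3) ℂ}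

/-- The map `ξ ↦ act A ξ` as a continuous linear map. -/
abbrev actCLM (A : Matrix (Fin 3) (Fin 3) ℂ) : C3 →L[ℂ] C3 :=
  Matrix.toEuclideanCLM (𝕜 := ℂ) A

lemma actCLM_apply (A : Matrix (Fin 3) (Fin 3) ℂ) (ξ : C3) : actCLM A ξ = act A ξ := rfl

lemma memLp_linearMap_matrix {Ω : Type*} [MeasurableSpace Ω] {μ : Measure Ω} {p : ℝ≥0∞}
    {n F : Type*} [Finite n] [NormedAddCommGroup F] [NormedSpace ℂ F]
    {A : Ω → Matrix n n ℂ} (hA : ∀ i j, MemLp (fun x => A x i j) p μ)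
    (L : Matrix n n ℂ →ₗ[ℂ] F) : MemLp (fun x => L (A x)) p μ := by
  classical
  have := Fintype.ofFinite n
  have hsum (x : Ω) : L (A x) = ∑ i, ∑ j, A x i j • L (Matrix.single i j 1) := by
    conv_lhs => rw [Matrix.matrix_eq_sum_single (A x)]
    simp only [map_sum, ← map_smul, Matrix.smul_single, smul_eq_mul, mul_one]
  rw [funext hsum]
  exact memLp_finsetSum _ fun i _ => memLp_finsetSum _ fun j _ =>
    MemLp.smul (p := p) (q := ∞) (memLp_top_const _) (hA i j)

lemma IsBoundedCoeff.memLp_actCLM (hA : IsBoundedCoeff A) :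
    MemLp (fun x => actCLM (A x)) ∞ volume :=
  memLp_linearMap_matrix hA
    (Matrix.toEuclideanCLM (n := Fin 3) (𝕜 := ℂ) : Matrix (Fin 3) (Fin 3) ℂ →ₗ[ℂ] C3 →L[ℂ] C3)

lemma IsHermitianCoeff.isSelfAdjoint_actCLM (hA : IsHermitianCoeff A) :
    ∀ᵐ x, IsSelfAdjoint (actCLM (A x)) :=
  hA.mono fun _ hx =>
    IsSelfAdjoint.map (Matrix.isHermitian_iff_isSelfAdjoint.1 hx) (Matrix.toEuclideanCLM (𝕜 := ℂ))

lemma actCLM_inv_mul_cancel {A : Matrix (Fin 3) (Fin 3) ℂ} (hA : IsUnit (actCLM A)) :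
    actCLM A⁻¹ * actCLM A = 1 := by
  rw [actCLM, MulEquiv.isUnit_map, Matrix.isUnit_iff_isUnit_det] at hA
  rw [actCLM, actCLM, ← map_mul, Matrix.nonsing_inv_mul _ hA, map_one]

lemma exists_isMulOp_isStrictlyPositive (hA : IsBoundedCoeff A) (hAh : IsHermitianCoeff A) {c : ℝ}
    (hc : 0 < c) (hcoer : ∀ᵐ x, ∀ ξ, c * ‖ξ‖ ^ 2 ≤ (inner ℂ ξ (act (A x) ξ)).re) :
    ∃ M : L2 →L[ℂ] L2, IsMulOp M (fun x => actCLM (A x)) ∧ IsStrictlyPositive M := by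
  obtain ⟨M, hM⟩ := exists_isMulOp hA.memLp_actCLM
  exact ⟨M, hM, hM.isStrictlyPositive hAh.isSelfAdjoint_actCLM hc hcoer⟩

lemma UniformlyElliptic.exists_isMulOp (hell : UniformlyElliptic P Q)
    (hP : IsBoundedCoeff P) (hQ : IsBoundedCoeff Q)
    (hPh : IsHermitianCoeff P) (hQh : IsHermitianCoeff Q) :
    ∃ MP R : L2 →L[ℂ] L2, IsMulOp MP (fun x => actCLM (P x)) ∧ IsStrictlyPositive MP ∧
      IsMulOp R (fun x => actCLM (Q x)⁻¹) ∧ IsStrictlyPositive R := by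
  obtain ⟨α, hα, hell⟩ := hell
  have hcoerP : ∀ᵐ x, ∀ ξ : C3, α * ‖ξ‖ ^ 2 ≤ (inner ℂ ξ (act (P x) ξ)).re :=
    hell.mono fun x hx ξ => (hx ξ).trans (min_le_left _ _)
  have hcoerQ : ∀ᵐ x, ∀ ξ : C3, α * ‖ξ‖ ^ 2 ≤ (inner ℂ ξ (act (Q x) ξ)).re :=
    hell.mono fun x hx ξ => (hx ξ).trans (min_le_right _ _)
  obtain ⟨MP, hMP, hMPpos⟩ := exists_isMulOp_isStrictlyPositive hP hPh hα hcoerP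
  obtain ⟨MQ, hMQ, hMQpos⟩ := exists_isMulOp_isStrictlyPositive hQ hQh hα hcoerQ
  refine ⟨MP, Ring.inverse MQ, hMP, hMPpos, hMQ.ringInverse hMQpos.isUnit ?_,
    isStrictlyPositive_ringInverse hMQpos⟩
  filter_upwards [hcoerQ, hQh.isSelfAdjoint_actCLM] with x hx hsa
  exact actCLM_inv_mul_cancel (isStrictlyPositive_of_coercive hsa hα hx).isUnit

variable {MP R : L2 →L[ℂ] L2}

lemma energy_eq (hMP : IsMulOp MP fun x => actCLM (P x)) (hR : IsMulOp R fun x => actCLM (Q x)⁻¹)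
    (E B : L2) : energy P Q E B = 1 / 2 * (inner ℂ B (R B) + inner ℂ E (MP E)).re := by
  rw [energy, hMP.inner_right, hR.inner_right,
    ← integral_add (hR.integrable_inner B B) (hMP.integrable_inner E E)]
  exact congrArg _ (integral_re ((hR.integrable_inner B B).add (hMP.integrable_inner E E)))

lemma power_eq (hR : IsMulOp R fun x => actCLM (Q x)⁻¹) (f g E B : L2) :
    power Q f g E B = (inner ℂ B (R f) + inner ℂ E g).re := by
  rw [power, hR.inner_right, MeasureTheory.L2.inner_def,
    ← integral_add (hR.integrable_inner B f) (MeasureTheory.L2.integrable_inner E g)]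
  exact integral_re ((hR.integrable_inner B f).add (MeasureTheory.L2.integrable_inner E g))

end Coefficients

section CurlGraph

open Filter Topology
open scoped SchwartzMap FourierTransform LineDeriv

/-- The matrices of the cross products `e_j × ·`. -/
def crossMatrix : Fin 3 → Matrix (Fin 3) (Fin 3) ℂ :=
  ![!![0, 0, 0; 0, 0, -1; 0, 1, 0], !![0, 0, 1; 0, 0, 0; -1, 0, 0], !![0, -1, 0; 1, 0, 0; 0, 0, 0]]

lemma star_crossMatrix (j : Fin 3) : star (crossMatrix j) = -crossMatrix j := by
  ext k l
  fin_cases j <;> fin_cases k <;> fin_cases l <;> simp [crossMatrix, Matrix.star_apply]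

lemma adjoint_actCLM_crossMatrix (j : Fin 3) :
    star (actCLM (crossMatrix j)) = -actCLM (crossMatrix j) := by
  rw [actCLM, ← map_star, star_crossMatrix, map_neg]

/-- The curl of a differentiable field as a function of its derivative. -/
def curlCLM : (R3 →L[ℝ] C3) →L[ℝ] C3 :=
  ∑ j, ((actCLM (crossMatrix j)).restrictScalars ℝ).comp
    (ContinuousLinearMap.apply ℝ C3 (EuclideanSpace.single j (1 : ℝ) : R3))

lemma curlCLM_apply (L : R3 →L[ℝ] C3) :
    curlCLM L = ∑ j, actCLM (crossMatrix j) (L (EuclideanSpace.single j 1)) := by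
  rw [curlCLM, sum_apply]
  rfl

lemma pderiv_eq {v : R3 → C3} {x : R3} (hv : DifferentiableAt ℝ v x) (j k : Fin 3) :
    pderiv v j k x = fderiv ℝ v x (EuclideanSpace.single j 1) k := by
  have hcomp := ((EuclideanSpace.proj k : C3 →L[ℂ] ℂ).restrictScalars ℝ).hasFDerivAt.comp x
    hv.hasFDerivAt
  exact congrArg (· (EuclideanSpace.single j 1)) hcomp.fderiv

lemma curl_eq_curlCLM {v : R3 → C3} {x : R3} (hv : DifferentiableAt ℝ v x) :
    curl v x = curlCLM (fderiv ℝ v x) := by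
  ext i
  simp only [curl, pderiv_eq hv, curlCLM_apply, actCLM_apply, act, Fin.sum_univ_three,
    crossMatrix, PiLp.add_apply, Matrix.mulVec, dotProduct]
  fin_cases i <;> simp <;> ring

/-- The curl of a Schwartz field. -/
def schwartzCurl (φ : 𝓢(R3, C3)) : 𝓢(R3, C3) :=
  ∑ j, (∂_{(EuclideanSpace.single j (1 : ℝ) : R3)} φ).postcompCLM (actCLM (crossMatrix j))

lemma schwartzCurl_apply (φ : 𝓢(R3, C3)) (x : R3) : schwartzCurl φ x = curl φ x := by
  rw [curl_eq_curlCLM φ.differentiableAt, curlCLM_apply, schwartzCurl, sum_apply]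
  rfl

lemma schwartzCurl_eq_curlCLM (φ : 𝓢(R3, C3)) (x : R3) :
    schwartzCurl φ x = curlCLM (fderiv ℝ φ x) := by
  rw [schwartzCurl_apply, curl_eq_curlCLM φ.differentiableAt]

/-- The Fourier symbol `2πi ξ ×` of the curl. -/
def curlSymbol (ξ : R3) : C3 →L[ℂ] C3 :=
  ∑ j, (2 * Real.pi * Complex.I * (ξ j : ℂ)) • actCLM (crossMatrix j)

lemma isSelfAdjoint_curlSymbol (ξ : R3) : IsSelfAdjoint (curlSymbol ξ) := by
  refine isSelfAdjoint_sum (R := C3 →L[ℂ] C3) _ fun j _ => ?_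
  rw [IsSelfAdjoint, star_smul, adjoint_actCLM_crossMatrix]
  simp

lemma inner_curlSymbol_left (ξ : R3) (v w : C3) :
    inner ℂ (curlSymbol ξ v) w = inner ℂ v (curlSymbol ξ w) :=
  (isSelfAdjoint_curlSymbol ξ).isSymmetric v w

lemma fourier_postcompCLM {E F G : Type*} [NormedAddCommGroup E] [InnerProductSpace ℝ E]
    [FiniteDimensional ℝ E] [MeasurableSpace E] [BorelSpace E] [NormedAddCommGroup F]
    [NormedSpace ℂ F] [CompleteSpace F] [NormedAddCommGroup G] [NormedSpace ℂ G] [CompleteSpace G]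
    (L : F →L[ℂ] G) (φ : 𝓢(E, F)) (ξ : E) : 𝓕 (φ.postcompCLM L) ξ = L (𝓕 φ ξ) := by
  rw [SchwartzMap.fourier_coe, SchwartzMap.fourier_coe, Real.fourier_eq, Real.fourier_eq,
    ← L.integral_comp_comm ((Real.fourierIntegral_convergent_iff ξ).2 φ.integrable)]
  refine integral_congr_ae (.of_forall fun x => ?_)
  simp only [SchwartzMap.postcompCLM_apply, Circle.smul_def, map_smul]

lemma fourier_lineDeriv_single (φ : 𝓢(R3, C3)) (j : Fin 3) (ξ : R3) :
    𝓕 (∂_{(EuclideanSpace.single j (1 : ℝ) : R3)} φ) ξ =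
      (2 * Real.pi * Complex.I * (ξ j : ℂ)) • 𝓕 φ ξ := by
  have hgrowth : (fun x : R3 =>
      inner ℝ x (EuclideanSpace.single j (1 : ℝ))).HasTemperateGrowth := by fun_prop
  rw [SchwartzMap.fourier_lineDerivOp_eq, smul_apply,
    SchwartzMap.smulLeftCLM_apply_apply hgrowth, EuclideanSpace.inner_single_right,
    ← Complex.coe_smul, smul_smul]
  simp

lemma fourier_schwartzCurl (φ : 𝓢(R3, C3)) (ξ : R3) :
    𝓕 (schwartzCurl φ) ξ = curlSymbol ξ (𝓕 φ ξ) := by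
  have hsum : 𝓕 (schwartzCurl φ) =
      ∑ j, 𝓕 ((∂_{(EuclideanSpace.single j (1 : ℝ) : R3)} φ).postcompCLM
        (actCLM (crossMatrix j))) :=
    map_sum (FourierTransform.fourierCLM ℂ 𝓢(R3, C3)) _ _
  rw [hsum, sum_apply, curlSymbol, sum_apply]
  refine Finset.sum_congr rfl fun j _ => ?_
  rw [fourier_postcompCLM, fourier_lineDeriv_single, map_smul, smul_apply]

/-- The graph of the weak curl operator on `L²`. -/
def curlGraph : Submodule ℂ (L2 × L2) where
  carrier := {p | ∀ φ : 𝓢(R3, C3), HasCompactSupport φ →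
    inner ℂ (φ.toLp 2) p.2 = inner ℂ ((schwartzCurl φ).toLp 2) p.1}
  add_mem' {p q} hp hq φ hφ := by
    rw [Prod.snd_add, Prod.fst_add, inner_add_right, inner_add_right, hp φ hφ, hq φ hφ]
  zero_mem' φ _ := by simp
  smul_mem' c p hp φ hφ := by
    rw [Prod.smul_snd, Prod.smul_fst, inner_smul_right, inner_smul_right, hp φ hφ]

lemma inner_toLp (φ : 𝓢(R3, C3)) (u : L2) :
    inner ℂ (φ.toLp 2) u = ∫ x, inner ℂ (φ x) (u x) := by
  rw [MeasureTheory.L2.inner_def]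
  refine integral_congr_ae ?_
  filter_upwards [φ.coeFn_toLp 2 (μ := volume)] with x hx
  rw [hx]

lemma inner_toLp_fourier (φ : 𝓢(R3, C3)) (u : L2) :
    inner ℂ (φ.toLp 2) u = ∫ ξ, inner ℂ (𝓕 φ ξ) ((𝓕 u : L2) ξ) := by
  rw [← inner_toLp, ← SchwartzMap.toLp_fourier_eq]
  exact (Lp.inner_fourier_eq _ _).symm

lemma inner_schwartzCurl_fourier (φ : 𝓢(R3, C3)) (u : L2) :
    inner ℂ ((schwartzCurl φ).toLp 2) u =
      ∫ ξ, inner ℂ (𝓕 φ ξ) (curlSymbol ξ ((𝓕 u : L2) ξ)) := by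
  simp only [inner_toLp_fourier, fourier_schwartzCurl, inner_curlSymbol_left]

section Cutoff

variable {E F : Type*} [NormedAddCommGroup E] [NormedSpace ℝ E]
  [NormedAddCommGroup F] [NormedSpace ℝ F]

lemma exists_cutoff_seq (E : Type*) [NormedAddCommGroup E] [NormedSpace ℝ E]
    [FiniteDimensional ℝ E] : ∃ (D : ℝ) (χ : ℕ → E → ℝ), ∀ n, ContDiff ℝ ∞ (χ n) ∧
      HasCompactSupport (χ n) ∧ (∀ x, ‖χ n x‖ ≤ 1) ∧ (∀ x, ‖fderiv ℝ (χ n) x‖ ≤ D) ∧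
      ∀ x, ‖x‖ < n → χ n =ᶠ[𝓝 x] 1 := by
  let χ : ContDiffBump (0 : E) := ⟨1, 2, one_pos, one_lt_two⟩
  obtain ⟨D, hD⟩ := (χ.hasCompactSupport.fderiv (𝕜 := ℝ)).exists_bound_of_continuous
    (χ.contDiff.continuous_fderiv (n := ∞) (by simp))
  let r : ℕ → ℝ := fun n => ((n : ℝ) + 1)⁻¹
  have hr (n) : 0 < r n := by positivity
  have hr_le (n) : r n ≤ 1 := inv_le_one_of_one_le₀ (by linarith [n.cast_nonneg (α := ℝ)])
  refine ⟨D, fun n x => χ (r n • x), fun n => ⟨?_, ?_, fun x => ?_, fun x => ?_, fun x hx => ?_⟩⟩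
  · exact χ.contDiff.comp (contDiff_const_smul (r n))
  · exact χ.hasCompactSupport.comp_homeomorph (Homeomorph.smulOfNeZero (r n) (hr n).ne')
  · rw [Real.norm_of_nonneg χ.nonneg]
    exact χ.le_one
  · rw [fderiv_comp_smul, norm_smul, Real.norm_of_nonneg (hr n).le]
    exact (mul_le_of_le_one_left (norm_nonneg _) (hr_le n)).trans (hD _)
  · filter_upwards [(continuous_norm.tendsto x).eventually (gt_mem_nhds hx)] with y hy
    refine χ.one_of_mem_closedBall ?_
    rw [mem_closedBall_zero_iff, norm_smul, Real.norm_of_nonneg (hr n).le,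
      inv_mul_le_one₀ (by positivity)]
    linarith

lemma norm_fderiv_smul_le {χ : E → ℝ} {φ : E → F} {x : E} (hχ : DifferentiableAt ℝ χ x)
    (hφ : DifferentiableAt ℝ φ x) : ‖fderiv ℝ (fun y => χ y • φ y) x‖ ≤
      ‖χ x‖ * ‖fderiv ℝ φ x‖ + ‖fderiv ℝ χ x‖ * ‖φ x‖ := by
  rw [fderiv_fun_smul hχ hφ]
  exact (norm_add_le _ _).trans_eq (by rw [norm_smul, ContinuousLinearMap.norm_smulRight_apply])

lemma exists_seq_hasCompactSupport [FiniteDimensional ℝ E] (φ : 𝓢(E, F)) :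
    ∃ (D : ℝ) (φn : ℕ → 𝓢(E, F)),
    (∀ n, HasCompactSupport (φn n)) ∧ (∀ x, ∀ᶠ n in atTop, φn n =ᶠ[𝓝 x] φ) ∧
    (∀ n x, ‖φn n x‖ ≤ ‖φ x‖) ∧ ∀ n x, ‖fderiv ℝ (φn n) x‖ ≤ ‖fderiv ℝ φ x‖ + D * ‖φ x‖ := by
  obtain ⟨D, χ, hχ⟩ := exists_cutoff_seq E
  have hsupp (n) : HasCompactSupport fun x => χ n x • φ x := (hχ n).2.1.smul_right
  refine ⟨D, fun n => (hsupp n).toSchwartzMap ((hχ n).1.smul φ.smooth'), hsupp, fun x => ?_,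
    fun n x => ?_, fun n x => ?_⟩
  · filter_upwards [tendsto_natCast_atTop_atTop.eventually_gt_atTop ‖x‖] with n hn
    filter_upwards [(hχ n).2.2.2.2 x hn] with y hy
    exact (congrArg (· • φ y) hy).trans (one_smul ℝ _)
  · refine (norm_smul_le (χ n x) (φ x)).trans ?_
    exact mul_le_of_le_one_left (norm_nonneg _) ((hχ n).2.2.1 x)
  · refine (norm_fderiv_smul_le ((hχ n).1.differentiable (by simp) x) φ.differentiableAt).trans ?_
    exact add_le_add (mul_le_of_le_one_left (norm_nonneg _) ((hχ n).2.2.1 x))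
      (mul_le_mul_of_nonneg_right ((hχ n).2.2.2.1 x) (norm_nonneg _))

end Cutoff

lemma tendsto_inner_toLp {φ : ℕ → 𝓢(R3, C3)} {ψ : 𝓢(R3, C3)} {b : R3 → ℝ} (hb : MemLp b 2 volume)
    (hφb : ∀ n x, ‖φ n x‖ ≤ b x) (hφψ : ∀ x, ∀ᶠ n in atTop, φ n x = ψ x) (u : L2) :
    Tendsto (fun n => inner ℂ ((φ n).toLp 2) u) atTop (𝓝 (inner ℂ (ψ.toLp 2) u)) := by
  simp only [inner_toLp]
  refine tendsto_integral_of_dominated_convergence (fun x => b x * ‖u x‖)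
    (fun n => (φ n).continuous.aestronglyMeasurable.inner (Lp.aestronglyMeasurable _))
    (hb.integrable_mul (Lp.memLp u).norm) (fun n => .of_forall fun x => ?_)
    (.of_forall fun x => ?_)
  · exact (norm_inner_le_norm _ _).trans (mul_le_mul_of_nonneg_right (hφb n x) (norm_nonneg _))
  · exact tendsto_const_nhds.congr' ((hφψ x).mono fun n hn => by simp only [hn])

lemma inner_eq_of_mem_curlGraph {p : L2 × L2} (hp : p ∈ curlGraph) (φ : 𝓢(R3, C3)) :
    inner ℂ (φ.toLp 2) p.2 = inner ℂ ((schwartzCurl φ).toLp 2) p.1 := by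
  obtain ⟨D, φn, hsupp, hloc, hbound, hbound'⟩ := exists_seq_hasCompactSupport φ
  have hφ : MemLp (fun x => ‖φ x‖) 2 volume := (φ.memLp 2).norm
  have hφ' : MemLp (fun x => ‖fderiv ℝ φ x‖) 2 volume :=
    ((SchwartzMap.fderivCLM ℝ R3 C3 φ).memLp 2 volume).norm
  have hlim := tendsto_inner_toLp hφ hbound (fun x => (hloc x).mono fun n hn => hn.eq_of_nhds) p.2
  have hlim' : Tendsto (fun n => inner ℂ ((schwartzCurl (φn n)).toLp 2) p.1) atTop
      (𝓝 (inner ℂ ((schwartzCurl φ).toLp 2) p.1)) := by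
    refine tendsto_inner_toLp ((hφ'.add (hφ.const_mul D)).const_mul ‖curlCLM‖) (fun n x => ?_)
      (fun x => (hloc x).mono fun n hn => ?_) p.1
    · rw [schwartzCurl_eq_curlCLM]
      exact (curlCLM.le_opNorm _).trans (mul_le_mul_of_nonneg_left (hbound' n x) (norm_nonneg _))
    · rw [schwartzCurl_eq_curlCLM, schwartzCurl_eq_curlCLM, hn.fderiv_eq]
  exact tendsto_nhds_unique hlim (hlim'.congr fun n => (hp (φn n) (hsupp n)).symm)

lemma locallyIntegrable_curlSymbol (u : L2) :
    LocallyIntegrable (fun ξ => curlSymbol ξ (u ξ)) volume := by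
  have hu : LocallyIntegrable u volume := (Lp.memLp u).locallyIntegrable one_le_two
  simp only [curlSymbol, sum_apply, smul_apply]
  refine locallyIntegrable_finsetSum _ fun j _ => locallyIntegrable_iff.2 fun K hK => ?_
  have hcross : IntegrableOn (fun ξ => actCLM (crossMatrix j) (u ξ)) K :=
    (actCLM (crossMatrix j)).integrable_comp (locallyIntegrable_iff.1 hu K hK)
  exact hcross.continuousOn_smul (Continuous.continuousOn (by fun_prop)) hK

lemma fourier_ae_eq_of_mem_curlGraph {p : L2 × L2} (hp : p ∈ curlGraph) :
    ∀ᵐ ξ, (𝓕 p.2 : L2) ξ = curlSymbol ξ ((𝓕 p.1 : L2) ξ) := by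
  have hint : LocallyIntegrable (𝓕 p.2 : L2) volume := (Lp.memLp _).locallyIntegrable one_le_two
  have hint' := locallyIntegrable_curlSymbol (𝓕 p.1)
  suffices h : ∀ᵐ ξ, (𝓕 p.2 : L2) ξ - curlSymbol ξ ((𝓕 p.1 : L2) ξ) = 0 from
    h.mono fun ξ hξ => sub_eq_zero.1 hξ
  refine ae_eq_zero_of_integral_contDiff_smul_eq_zero (hint.sub hint') fun η hη hsupp => ?_
  have hη_int := hint.integrable_smul_left_of_hasCompactSupport hη.continuous hsupp
  have hη_int' := hint'.integrable_smul_left_of_hasCompactSupport hη.continuous hsupp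
  simp only [smul_sub]
  rw [integral_sub hη_int hη_int', sub_eq_zero]
  refine ext_inner_left ℂ fun c => ?_
  have hψ : HasCompactSupport fun ξ => η ξ • c := hsupp.smul_right
  let ψ : 𝓢(R3, C3) := hψ.toSchwartzMap (hη.smul contDiff_const)
  have hinner (ξ : R3) (w : C3) : inner ℂ (ψ ξ) w = inner ℂ c (η ξ • w) := by
    change inner ℂ (η ξ • c) w = _
    rw [← Complex.coe_smul, ← Complex.coe_smul, inner_smul_left, inner_smul_right,
      Complex.conj_ofReal]
  have htest := inner_eq_of_mem_curlGraph hp (𝓕⁻ ψ)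
  rw [inner_toLp_fourier, inner_schwartzCurl_fourier] at htest
  simp only [FourierTransform.fourier_fourierInv_eq, hinner] at htest
  rwa [← integral_inner hη_int, ← integral_inner hη_int']

lemma mem_curlGraph_iff (p : L2 × L2) : p ∈ curlGraph ↔
    ∀ᵐ ξ, (𝓕 p.2 : L2) ξ = curlSymbol ξ ((𝓕 p.1 : L2) ξ) := by
  refine ⟨fourier_ae_eq_of_mem_curlGraph, fun h φ _ => ?_⟩
  rw [inner_toLp_fourier, inner_schwartzCurl_fourier]
  exact integral_congr_ae (h.mono fun ξ hξ => by simp only [hξ])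

lemma schwartz_mem_curlGraph (φ : 𝓢(R3, C3)) :
    (φ.toLp 2 volume, (schwartzCurl φ).toLp 2 volume) ∈ curlGraph := by
  rw [mem_curlGraph_iff]
  simp only [SchwartzMap.toLp_fourier_eq]
  filter_upwards [(𝓕 φ).coeFn_toLp 2 volume,
    (𝓕 (schwartzCurl φ)).coeFn_toLp 2 volume] with ξ hφ hcurl
  rw [hφ, hcurl, fourier_schwartzCurl]

lemma isSelfAdjointGraph_curlGraph : IsSelfAdjointGraph curlGraph where
  mem_iff p := by
    refine ⟨fun hp q hq => ?_, fun h φ _ => (h _ (schwartz_mem_curlGraph φ)).symm⟩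
    rw [← Lp.inner_fourier_eq, ← Lp.inner_fourier_eq q.1, MeasureTheory.L2.inner_def,
      MeasureTheory.L2.inner_def]
    refine integral_congr_ae ?_
    filter_upwards [(mem_curlGraph_iff p).1 hp, (mem_curlGraph_iff q).1 hq] with ξ hpξ hqξ
    rw [hpξ, hqξ, inner_curlSymbol_left]
  eq_zero_of_zero_mem {y} hy := by
    refine (Lp.fourierTransformₗᵢ R3 C3).map_eq_zero_iff.1 (Lp.ext ?_)
    have hzero : 𝓕 (0 : L2) = 0 := map_zero (Lp.fourierTransformₗᵢ R3 C3)
    filter_upwards [(mem_curlGraph_iff _).1 hy, Lp.coeFn_zero C3 2 (volume : Measure R3)]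
      with ξ hξ hξ0
    rw [hzero, hξ0, Pi.zero_apply, map_zero] at hξ
    rw [hξ0]
    exact hξ

end CurlGraph

section Slices

open Filter Topology

variable {X V : Type*} [PseudoMetricSpace X] [NormedAddCommGroup V] {F F' : ℝ × X → V}

lemma apply_eq_zero_of_notMem_snd_image {t : ℝ} {x : X} (hx : x ∉ Prod.snd '' tsupport F) :
    F (t, x) = 0 :=
  image_eq_zero_of_notMem_tsupport fun h => hx (mem_image_of_mem Prod.snd h)

lemma hasCompactSupport_slice (hc : HasCompactSupport F) (t : ℝ) :
    HasCompactSupport fun x => F (t, x) :=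
  HasCompactSupport.intro (hc.image continuous_snd) fun _ => apply_eq_zero_of_notMem_snd_image

variable [MeasurableSpace X] [BorelSpace X] {μ : Measure X} [IsFiniteMeasureOnCompacts μ]
  {p : ℝ≥0∞}

lemma memLp_slice (p : ℝ≥0∞) (μ : Measure X) [IsFiniteMeasureOnCompacts μ] (hF : Continuous F)
    (hc : HasCompactSupport F) (t : ℝ) : MemLp (fun x => F (t, x)) p μ :=
  (hF.comp (Continuous.prodMk_right t)).memLp_of_hasCompactSupport (hasCompactSupport_slice hc t)

/-- The slices `F(t, ·)` of a continuous function with compact support, as elements of `L^p`. -/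
def sliceLp (p : ℝ≥0∞) (μ : Measure X) [IsFiniteMeasureOnCompacts μ] (hF : Continuous F)
    (hc : HasCompactSupport F) (t : ℝ) : Lp V p μ :=
  (memLp_slice p μ hF hc t).toLp

lemma coeFn_sliceLp (hF : Continuous F) (hc : HasCompactSupport F) (t : ℝ) :
    sliceLp p μ hF hc t =ᵐ[μ] fun x => F (t, x) :=
  (memLp_slice p μ hF hc t).coeFn_toLp

variable [Fact (1 ≤ p)]

lemma exists_norm_toLp_le {K : Set X} (hK : IsCompact K) : ∃ M : ℝ, 0 < M ∧
    ∀ {v : X → V} (hv : MemLp v p μ) {ε : ℝ}, 0 ≤ ε → (∀ x, ‖v x‖ ≤ ε) → (∀ x ∉ K, v x = 0) →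
      ‖hv.toLp‖ ≤ ε * M := by
  have hK' : MeasurableSet (closure K) := measurableSet_closure
  have hfin : μ (closure K) ≠ ⊤ := hK.closure.measure_lt_top.ne
  let w : Lp ℝ p μ := indicatorConstLp p hK' hfin 1
  refine ⟨‖w‖ + 1, by positivity, fun {v} hv {ε} hε0 hε hv0 => ?_⟩
  refine (Lp.norm_le_mul_norm_of_ae_le_mul (g := w) (c := ε) ?_).trans
    (mul_le_mul_of_nonneg_left (le_add_of_nonneg_right zero_le_one) hε0)
  filter_upwards [hv.coeFn_toLp, indicatorConstLp_coeFn (p := p) (hs := hK') (hμs := hfin)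
    (c := (1 : ℝ))] with x hx hw
  rw [hx, hw]
  by_cases hxK : x ∈ closure K
  · simpa [hxK] using hε x
  · simp [hxK, hv0 x fun h => hxK (subset_closure h)]

lemma continuous_sliceLp (hF : Continuous F) (hc : HasCompactSupport F) :
    Continuous (sliceLp p μ hF hc) := by
  obtain ⟨M, hM, hnorm⟩ := exists_norm_toLp_le (V := V) (p := p) (μ := μ) (hc.image continuous_snd)
  refine Metric.continuous_iff.2 fun t ε hε => ?_
  obtain ⟨δ, hδ, hunif⟩ := Metric.uniformContinuous_iff.1 (hc.uniformContinuous_of_continuous hF)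
    (ε / (2 * M)) (by positivity)
  refine ⟨δ, hδ, fun s hs => ?_⟩
  have hle : ‖sliceLp p μ hF hc s - sliceLp p μ hF hc t‖ ≤ ε / (2 * M) * M := by
    rw [sliceLp, sliceLp, ← MemLp.toLp_sub]
    refine hnorm _ (by positivity) (fun x => ?_) fun x hx => ?_
    · rw [Pi.sub_apply, ← dist_eq_norm]
      exact (hunif (by simpa [Prod.dist_eq] using hs)).le
    · rw [Pi.sub_apply, apply_eq_zero_of_notMem_snd_image hx,
        apply_eq_zero_of_notMem_snd_image hx, sub_zero]
  have hhalf : ε / (2 * M) * M = ε / 2 := by field_simp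
  rw [dist_eq_norm]
  linarith

variable [NormedSpace ℝ V]

lemma norm_sub_sub_smul_le {γ γ' : ℝ → V} {s t ε δ : ℝ} (hγ : ∀ r, HasDerivAt γ (γ' r) r)
    (hγ' : ∀ r ∈ Metric.ball t δ, ‖γ' r - γ' t‖ ≤ ε) (hs : s ∈ Metric.ball t δ) :
    ‖γ s - γ t - (s - t) • γ' t‖ ≤ ε * ‖s - t‖ := by
  have hderiv (r : ℝ) : HasDerivAt (fun r => γ r - r • γ' t) (γ' r - γ' t) r := by
    simpa using (hγ r).fun_sub ((hasDerivAt_id r).smul_const (γ' t))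
  have hmvt := (convex_ball t δ).norm_image_sub_le_of_norm_hasDerivWithin_le
    (fun r _ => (hderiv r).hasDerivWithinAt) hγ' (Metric.mem_ball_self (dist_nonneg.trans_lt hs)) hs
  convert hmvt using 2
  module

lemma hasDerivAt_sliceLp (hF : Continuous F) (hc : HasCompactSupport F) (hF' : Continuous F')
    (hc' : HasCompactSupport F') (hderiv : ∀ t x, HasDerivAt (fun s => F (s, x)) (F' (t, x)) t)
    (t : ℝ) : HasDerivAt (sliceLp p μ hF hc) (sliceLp p μ hF' hc' t) t := by
  obtain ⟨M, hM, hnorm⟩ := exists_norm_toLp_le (V := V) (p := p) (μ := μ)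
    ((hc.image continuous_snd).union (hc'.image continuous_snd))
  refine .of_isLittleO (Asymptotics.isLittleO_iff.2 fun ε hε => ?_)
  obtain ⟨δ, hδ, hunif⟩ := Metric.uniformContinuous_iff.1 (hc'.uniformContinuous_of_continuous hF')
    (ε / M) (by positivity)
  filter_upwards [Metric.ball_mem_nhds t hδ] with s hs
  have hle : ‖sliceLp p μ hF hc s - sliceLp p μ hF hc t - (s - t) • sliceLp p μ hF' hc' t‖
      ≤ ε / M * ‖s - t‖ * M := by
    rw [sliceLp, sliceLp, sliceLp, ← MemLp.toLp_sub, ← MemLp.toLp_const_smul, ← MemLp.toLp_sub]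
    refine hnorm _ (by positivity) (fun x => ?_) fun x hx => ?_
    · refine norm_sub_sub_smul_le (δ := δ) (fun r => hderiv r x) (fun r hr => ?_) hs
      rw [← dist_eq_norm]
      exact (hunif (by simpa [Prod.dist_eq] using hr)).le
    · rw [mem_union, not_or] at hx
      simp [apply_eq_zero_of_notMem_snd_image hx.1, apply_eq_zero_of_notMem_snd_image hx.2]
  exact hle.trans_eq (by field_simp)

end Slices

section TestFields

open Filter Topology
open scoped SchwartzMap

variable {T : ℝ} {φ : ℝ → R3 → C3}

/-- The `L²` curves `u`, `u'`, `w` are made of the slices of the field `φ`, of its time derivative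
and of its curl. -/
structure IsSliceCurve (φ : ℝ → R3 → C3) (u u' w : ℝ → L2) : Prop where
  coeFn (t : ℝ) : u t =ᵐ[volume] φ t
  coeFn_deriv (t : ℝ) : u' t =ᵐ[volume] fun x => deriv (fun s => φ s x) t
  coeFn_curl (t : ℝ) : w t =ᵐ[volume] curl (φ t)

lemma mem_curlGraph_of_ae_eq {v : R3 → C3} (hv : ContDiff ℝ ∞ v) (hc : HasCompactSupport v)
    {u w : L2} (hu : u =ᵐ[volume] v) (hw : w =ᵐ[volume] curl v) : (u, w) ∈ curlGraph := by
  convert schwartz_mem_curlGraph (hc.toSchwartzMap hv) using 2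
  · exact Lp.ext (hu.trans (SchwartzMap.coeFn_toLp (hc.toSchwartzMap hv) 2 volume).symm)
  · refine Lp.ext (hw.trans ?_)
    filter_upwards [(schwartzCurl (hc.toSchwartzMap hv)).coeFn_toLp 2 volume] with x hx
    exact ((schwartzCurl_apply _ x).symm.trans hx.symm)

namespace IsTestField

lemma hasDerivAt (h : IsTestField T φ) (t : ℝ) (x : R3) :
    HasDerivAt (fun s => φ s x) (fderiv ℝ (Function.uncurry φ) (t, x) (1, 0)) t :=
  (h.smooth.differentiable (by simp) (t, x)).hasFDerivAt.comp_hasDerivAt (f := fun s => (s, x)) t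
    ((hasDerivAt_id t).prodMk (hasDerivAt_const t x))

lemma curl_eq (h : IsTestField T φ) (t : ℝ) (x : R3) : curl (φ t) x =
    curlCLM ((fderiv ℝ (Function.uncurry φ) (t, x)).comp (ContinuousLinearMap.inr ℝ ℝ R3)) := by
  have hφ : HasFDerivAt (φ t)
      ((fderiv ℝ (Function.uncurry φ) (t, x)).comp (ContinuousLinearMap.inr ℝ ℝ R3)) x :=
    (h.smooth.differentiable (by simp) (t, x)).hasFDerivAt.comp (f := fun y => (t, y)) x
      (hasFDerivAt_prodMk_right t x)
  rw [curl_eq_curlCLM hφ.differentiableAt, hφ.fderiv]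

lemma exists_isTestCurve (h : IsTestField T φ) : ∃ u u' w : ℝ → L2,
    IsTestCurve curlGraph T u u' w ∧ IsSliceCurve φ u u' w := by
  have hfderiv : Continuous (fderiv ℝ (Function.uncurry φ)) := h.smooth.continuous_fderiv (by simp)
  have hderiv : Continuous fun z => fderiv ℝ (Function.uncurry φ) z (1, 0) :=
    hfderiv.clm_apply continuous_const
  have hcurl : Continuous fun z => curlCLM ((fderiv ℝ (Function.uncurry φ) z).comp
      (ContinuousLinearMap.inr ℝ ℝ R3)) :=
    curlCLM.continuous.comp (hfderiv.clm_comp continuous_const)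
  have hderiv_supp := h.compact.fderiv_apply (𝕜 := ℝ) (1, 0)
  have hcurl_supp : HasCompactSupport fun z => curlCLM ((fderiv ℝ (Function.uncurry φ) z).comp
      (ContinuousLinearMap.inr ℝ ℝ R3)) :=
    (h.compact.fderiv (𝕜 := ℝ)).mono fun z hz hz0 => hz (by
      simp only [hz0, ContinuousLinearMap.zero_comp, map_zero])
  have hslice : IsSliceCurve φ (sliceLp 2 volume h.smooth.continuous h.compact)
      (sliceLp 2 volume hderiv hderiv_supp) (sliceLp 2 volume hcurl hcurl_supp) :=
    { coeFn := coeFn_sliceLp _ _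
      coeFn_deriv t := by simpa only [(h.hasDerivAt t _).deriv] using coeFn_sliceLp hderiv _ t
      coeFn_curl t := by simpa only [funext (h.curl_eq t)] using coeFn_sliceLp hcurl _ t }
  refine ⟨_, _, _, ⟨hasDerivAt_sliceLp _ _ _ _ h.hasDerivAt, continuous_sliceLp _ _,
    continuous_sliceLp _ _, fun t => ?_, ?_⟩, hslice⟩
  · exact mem_curlGraph_of_ae_eq (h.smooth.comp (contDiff_prodMk_right t))
      (hasCompactSupport_slice h.compact t) (hslice.coeFn t) (hslice.coeFn_curl t)
  · refine Lp.ext ((hslice.coeFn T).trans (.trans (.of_forall fun x => ?_)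
      (Lp.coeFn_zero C3 2 volume).symm))
    exact image_eq_zero_of_notMem_tsupport (f := Function.uncurry φ) (x := (T, x)) fun hx =>
      lt_irrefl T (h.support hx).1

end IsTestField

section ProductFields

variable {η : ℝ → ℝ} {ζ : 𝓢(R3, C3)}

lemma isTestField_smul (hη : ContDiff ℝ ∞ η) (hc : HasCompactSupport η) (hT : tsupport η ⊆ Iio T)
    (hζ : HasCompactSupport ζ) : IsTestField T fun t x => η t • ζ x where
  smooth := (hη.comp contDiff_fst).smul (ζ.smooth'.comp contDiff_snd)
  compact := HasCompactSupport.intro (hc.prod hζ) fun z hz => by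
    rw [mem_prod, not_and_or] at hz
    rcases hz with hz | hz <;> simp [Function.uncurry, image_eq_zero_of_notMem_tsupport hz]
  support := by
    refine (closure_minimal (t := tsupport η ×ˢ univ) (fun z hz => ⟨?_, mem_univ _⟩)
      ((isClosed_tsupport η).prod isClosed_univ)).trans (prod_mono_left hT)
    refine subset_tsupport η fun h0 => hz ?_
    simp [Function.uncurry, h0]

lemma curl_smul (c : ℝ) (ζ : 𝓢(R3, C3)) (x : R3) :
    curl (fun y => c • ζ y) x = c • schwartzCurl ζ x := by
  rw [schwartzCurl_eq_curlCLM, ← map_smul,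
    curl_eq_curlCLM (v := fun y => c • ζ y) (ζ.differentiableAt.const_smul c)]
  exact congrArg curlCLM (fderiv_const_smul ζ.differentiableAt c)

lemma isSliceCurve_smul (hη : Differentiable ℝ η) (ζ : 𝓢(R3, C3)) :
    IsSliceCurve (fun t x => η t • ζ x) (fun t => η t • ζ.toLp 2 volume)
      (fun t => deriv η t • ζ.toLp 2 volume)
      (fun t => η t • (schwartzCurl ζ).toLp 2 volume) := by
  have hsmul (c : ℝ) (ψ : 𝓢(R3, C3)) : c • ψ.toLp 2 volume =ᵐ[volume] fun x => c • ψ x :=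
    (Lp.coeFn_smul c _).trans ((ψ.coeFn_toLp 2 volume).fun_const_smul c)
  refine ⟨fun t => hsmul _ ζ, fun t => ?_, fun t => ?_⟩
  · simpa only [deriv_smul_const (hη t)] using hsmul (deriv η t) ζ
  · rw [funext (curl_smul (η t) ζ)]
    exact hsmul (η t) (schwartzCurl ζ)

end ProductFields

section WeakForm

variable {φ φ' ψ : ℝ → L2} {P Q : R3 → Matrix (Fin 3) (Fin 3) ℂ} {MP R : L2 →L[ℂ] L2}
  {Φ : ℝ → R3 → C3}

namespace IsSliceCurve

lemma integral_inner_eq (h : IsSliceCurve Φ φ φ' ψ) (t : ℝ) (u : L2) :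
    ∫ x, inner ℂ (Φ t x) (u x) = inner ℂ (φ t) u := by
  rw [MeasureTheory.L2.inner_def]
  exact integral_congr_ae ((h.coeFn t).mono fun x hx => by simp only [hx])

lemma integral_inner_mulOp_eq (h : IsSliceCurve Φ φ φ' ψ) (hMP : IsMulOp MP fun x => actCLM (P x))
    (t : ℝ) (u : L2) : ∫ x, inner ℂ (Φ t x) (act (P x) (u x)) = inner ℂ (φ t) (MP u) := by
  rw [← h.integral_inner_eq]
  exact integral_congr_ae ((hMP u).mono fun x hx => by simp only [hx, actCLM_apply])

lemma integral_faraday_eq (h : IsSliceCurve Φ φ φ' ψ) (t : ℝ) (E B : L2) :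
    ∫ x, (-inner ℂ (deriv (fun s => Φ s x) t) (B x) + inner ℂ (curl (Φ t) x) (E x)) =
      -inner ℂ (φ' t) B + inner ℂ (ψ t) E := by
  rw [← inner_neg_left, MeasureTheory.L2.inner_def, MeasureTheory.L2.inner_def,
    ← integral_add (MeasureTheory.L2.integrable_inner _ _)
      (MeasureTheory.L2.integrable_inner _ _)]
  refine integral_congr_ae ?_
  filter_upwards [h.coeFn_deriv t, h.coeFn_curl t, Lp.coeFn_neg (φ' t)] with x hderiv hcurl hneg
  rw [hneg, Pi.neg_apply, inner_neg_left, hderiv, hcurl]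

lemma integral_ampere_eq (h : IsSliceCurve Φ φ φ' ψ) (hMP : IsMulOp MP fun x => actCLM (P x))
    (hR : IsMulOp R fun x => actCLM (Q x)⁻¹) (t : ℝ) (E B : L2) :
    ∫ x, (-inner ℂ (deriv (fun s => Φ s x) t) (act (P x) (E x))
        - inner ℂ (curl (Φ t) x) (act (Q x)⁻¹ (B x))) =
      -inner ℂ (φ' t) (MP E) - inner ℂ (ψ t) (R B) := by
  rw [sub_eq_add_neg, ← inner_neg_right (y := R B), ← h.integral_faraday_eq]
  refine integral_congr_ae ?_
  filter_upwards [hMP E, hR B, Lp.coeFn_neg (R B)] with x hE hB hneg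
  rw [hneg, Pi.neg_apply, hE, hB, inner_neg_right, sub_eq_add_neg, actCLM_apply, actCLM_apply]

end IsSliceCurve

variable {T : ℝ} {f g : LpL2 1 T} {E₀ B₀ : L2} {E B : LpL2 ∞ T}

namespace IsWeakSolution

lemma faraday_slice (h : IsWeakSolution T P Q f g E₀ B₀ E B) (hΦ : IsTestField T Φ)
    (hslice : IsSliceCurve Φ φ φ' ψ) :
    ∫ t in Ioo 0 T, (-inner ℂ (φ' t) (B t) + inner ℂ (ψ t) (E t)) =
      (∫ t in Ioo 0 T, inner ℂ (φ t) (f t)) + inner ℂ (φ 0) B₀ := by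
  simpa only [hslice.integral_faraday_eq, hslice.integral_inner_eq] using h.faraday Φ hΦ

lemma ampere_slice (h : IsWeakSolution T P Q f g E₀ B₀ E B)
    (hMP : IsMulOp MP fun x => actCLM (P x)) (hR : IsMulOp R fun x => actCLM (Q x)⁻¹)
    (hΦ : IsTestField T Φ) (hslice : IsSliceCurve Φ φ φ' ψ) :
    ∫ t in Ioo 0 T, (-inner ℂ (φ' t) (MP (E t)) - inner ℂ (ψ t) (R (B t))) =
      (∫ t in Ioo 0 T, inner ℂ (φ t) (g t)) + inner ℂ (φ 0) (MP E₀) := by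
  simpa only [hslice.integral_ampere_eq hMP hR, hslice.integral_inner_eq,
    hslice.integral_inner_mulOp_eq hMP] using h.ampere Φ hΦ

end IsWeakSolution

lemma isWeakSolution_of_isTestCurve (hMP : IsMulOp MP fun x => actCLM (P x))
    (hR : IsMulOp R fun x => actCLM (Q x)⁻¹)
    (faraday : ∀ φ φ' ψ : ℝ → L2, IsTestCurve curlGraph T φ φ' ψ →
      ∫ t in Ioo 0 T, (-inner ℂ (φ' t) (B t) + inner ℂ (ψ t) (E t)) =
        (∫ t in Ioo 0 T, inner ℂ (φ t) (f t)) + inner ℂ (φ 0) B₀)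
    (ampere : ∀ φ φ' ψ : ℝ → L2, IsTestCurve curlGraph T φ φ' ψ →
      ∫ t in Ioo 0 T, (-inner ℂ (φ' t) (MP (E t)) - inner ℂ (ψ t) (R (B t))) =
        (∫ t in Ioo 0 T, inner ℂ (φ t) (g t)) + inner ℂ (φ 0) (MP E₀)) :
    IsWeakSolution T P Q f g E₀ B₀ E B where
  faraday Φ hΦ := by
    obtain ⟨φ, φ', ψ, hφ, hslice⟩ := hΦ.exists_isTestCurve
    simpa only [hslice.integral_faraday_eq, hslice.integral_inner_eq] using faraday φ φ' ψ hφ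
  ampere Φ hΦ := by
    obtain ⟨φ, φ', ψ, hφ, hslice⟩ := hΦ.exists_isTestCurve
    simpa only [hslice.integral_ampere_eq hMP hR, hslice.integral_inner_eq,
      hslice.integral_inner_mulOp_eq hMP] using ampere φ φ' ψ hφ

end WeakForm

end TestFields

section TimeMoments

open scoped SchwartzMap

variable {T : ℝ} {η : ℝ → ℝ}

lemma integrableOn_coeFn {p : ℝ≥0∞} (hp : 1 ≤ p) (u : LpL2 p T) : IntegrableOn u (Ioo 0 T) :=
  (Lp.memLp u).integrable hp

lemma integral_smul_sub {X : Type*} [NormedAddCommGroup X] [NormedSpace ℝ X] {u v : ℝ → X}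
    {s : Set ℝ} (hη : Continuous η) (hc : HasCompactSupport η) (hu : IntegrableOn u s)
    (hv : IntegrableOn v s) :
    ∫ t in s, η t • (u t - v t) = (∫ t in s, η t • u t) - ∫ t in s, η t • v t := by
  simp only [smul_sub]
  exact integral_sub (integrableOn_smul hη hc hu) (integrableOn_smul hη hc hv)

lemma inner_real_smul_left_eq (a : ℝ) (x y : L2) : inner ℂ (a • x) y = inner ℂ x (a • y) := by
  simp only [← Complex.coe_smul, inner_smul_left_eq_smul, inner_smul_right_eq_smul]

lemma integral_inner_smul_left {v : ℝ → L2} {s : Set ℝ} (hη : Continuous η)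
    (hc : HasCompactSupport η) (hv : IntegrableOn v s) (z : L2) :
    ∫ t in s, inner ℂ (η t • z) (v t) = inner ℂ z (∫ t in s, η t • v t) := by
  simp only [inner_real_smul_left_eq]
  exact integral_inner (integrableOn_smul hη hc hv) z

lemma moment_mem_curlGraph {s : Set ℝ} {v w h : ℝ → L2} {w₀ : L2} (hη : ContDiff ℝ 1 η)
    (hc : HasCompactSupport η) (hv : IntegrableOn v s) (hw : IntegrableOn w s)
    (hh : IntegrableOn h s) (H : ∀ ζ : 𝓢(R3, C3), HasCompactSupport ζ →
      ∫ t in s, (-inner ℂ (deriv η t • ζ.toLp 2 volume) (w t)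
          + inner ℂ (η t • (schwartzCurl ζ).toLp 2 volume) (v t)) =
        (∫ t in s, inner ℂ (η t • ζ.toLp 2 volume) (h t)) + inner ℂ (η 0 • ζ.toLp 2 volume) w₀) :
    (∫ t in s, η t • v t, (∫ t in s, deriv η t • w t) + ((∫ t in s, η t • h t) + η 0 • w₀))
      ∈ curlGraph := by
  have hη' : Continuous (deriv η) := hη.continuous_deriv le_rfl
  intro ζ hζ
  have hint (z : L2) : IntegrableOn (fun t => -inner ℂ (deriv η t • z) (w t)) s := by
    simp only [inner_real_smul_left_eq]
    exact ((integrableOn_smul hη' hc.deriv hw).const_inner z).neg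
  have hint' (z : L2) : IntegrableOn (fun t => inner ℂ (η t • z) (v t)) s := by
    simp only [inner_real_smul_left_eq]
    exact (integrableOn_smul hη.continuous hc hv).const_inner z
  have htest := H ζ hζ
  rw [integral_add (hint _) (hint' _), integral_neg,
    integral_inner_smul_left hη' hc.deriv hw, integral_inner_smul_left hη.continuous hc hv,
    integral_inner_smul_left hη.continuous hc hh,
    inner_real_smul_left_eq] at htest
  simp only [inner_add_right]
  linear_combination -htest

variable {P Q : R3 → Matrix (Fin 3) (Fin 3) ℂ} {MP R : L2 →L[ℂ] L2} {f g : LpL2 1 T} {E₀ B₀ : L2}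
  {E B : LpL2 ∞ T}

namespace IsWeakSolution

lemma faraday_moment (h : IsWeakSolution T P Q f g E₀ B₀ E B) (hη : ContDiff ℝ ∞ η)
    (hc : HasCompactSupport η) (hT : tsupport η ⊆ Iio T) :
    (∫ t in Ioo 0 T, η t • E t, (∫ t in Ioo 0 T, deriv η t • B t) +
      ((∫ t in Ioo 0 T, η t • f t) + η 0 • B₀)) ∈ curlGraph :=
  moment_mem_curlGraph (hη.of_le (by simp)) hc (integrableOn_coeFn le_top E)
    (integrableOn_coeFn le_top B) (integrableOn_coeFn le_rfl f) fun ζ hζ =>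
      h.faraday_slice (isTestField_smul hη hc hT hζ)
        (isSliceCurve_smul (hη.differentiable (by simp)) ζ)

lemma ampere_moment (h : IsWeakSolution T P Q f g E₀ B₀ E B)
    (hMP : IsMulOp MP fun x => actCLM (P x)) (hR : IsMulOp R fun x => actCLM (Q x)⁻¹)
    (hη : ContDiff ℝ ∞ η) (hc : HasCompactSupport η) (hT : tsupport η ⊆ Iio T) :
    (R (∫ t in Ioo 0 T, η t • B t), -(MP (∫ t in Ioo 0 T, deriv η t • E t) +
      ((∫ t in Ioo 0 T, η t • g t) + η 0 • MP E₀))) ∈ curlGraph := by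
  have hE := integrableOn_coeFn le_top E
  have hB := integrableOn_coeFn le_top B
  have hmem := curlGraph.neg_mem <| moment_mem_curlGraph (v := fun t => -R (B t))
    (w := fun t => MP (E t)) (hη.of_le (by simp)) hc (R.integrable_comp hB).neg
    (MP.integrable_comp hE) (integrableOn_coeFn le_rfl g) fun ζ hζ => by
      simpa only [inner_neg_right, ← sub_eq_add_neg] using
        h.ampere_slice hMP hR (isTestField_smul hη hc hT hζ)
          (isSliceCurve_smul (hη.differentiable (by simp)) ζ)
  rw [← R.integral_comp_comm (integrableOn_smul hη.continuous hc hB),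
    ← MP.integral_comp_comm (integrableOn_smul (hη.continuous_deriv (by simp)) hc.deriv hE)]
  simpa only [Prod.neg_mk, smul_neg, integral_neg, neg_neg,
    ContinuousLinearMap.map_smul_of_tower] using hmem

lemma eq_and_eq {E' B' : LpL2 ∞ T} (h : IsWeakSolution T P Q f g E₀ B₀ E B)
    (h' : IsWeakSolution T P Q f g E₀ B₀ E' B') (hMP : IsMulOp MP fun x => actCLM (P x))
    (hMPpos : IsStrictlyPositive MP) (hR : IsMulOp R fun x => actCLM (Q x)⁻¹)
    (hRpos : IsStrictlyPositive R) : E = E' ∧ B = B' := by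
  obtain ⟨p, hp⟩ := exists_isSqrt hMPpos
  obtain ⟨r, hr⟩ := exists_isSqrt hRpos
  have hE := integrableOn_coeFn le_top E
  have hE' := integrableOn_coeFn le_top E'
  have hB := integrableOn_coeFn le_top B
  have hB' := integrableOn_coeFn le_top B'
  have hzero := electric_magnetic_ae_eq_zero (E := fun t => E t - E' t) (B := fun t => B t - B' t)
    isSelfAdjointGraph_curlGraph hp hr (hE.sub hE') (hB.sub hB')
    (fun η hη hc hT => by
      have hη' := hη.continuous_deriv (by simp)
      have hmem := curlGraph.sub_mem (h.faraday_moment hη hc hT) (h'.faraday_moment hη hc hT)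
      rw [Prod.mk_sub_mk, add_sub_add_right_eq_sub, ← integral_smul_sub hη.continuous hc hE hE',
        ← integral_smul_sub hη' hc.deriv hB hB'] at hmem
      exact hmem)
    (fun η hη hc hT => by
      have hη' := hη.continuous_deriv (by simp)
      have hmem := curlGraph.sub_mem (h.ampere_moment hMP hR hη hc hT)
        (h'.ampere_moment hMP hR hη hc hT)
      rw [Prod.mk_sub_mk, neg_sub_neg, add_sub_add_right_eq_sub, ← map_sub, ← map_sub,
        ← integral_smul_sub hη.continuous hc hB hB', ← neg_sub,
        ← integral_smul_sub hη' hc.deriv hE hE', map_neg] at hmem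
      exact hmem)
  rw [← ae_restrict_iff' measurableSet_Ioo] at hzero
  exact ⟨Lp.ext (hzero.mono fun t ht => sub_eq_zero.1 ht.1),
    Lp.ext (hzero.mono fun t ht => sub_eq_zero.1 ht.2)⟩

end IsWeakSolution

end TimeMoments

section WellPosedness

variable {T : ℝ} {P Q : R3 → Matrix (Fin 3) (Fin 3) ℂ} {MP R : L2 →L[ℂ] L2} {p r : L2 ≃L[ℂ] L2}
  {f g : LpL2 1 T} {E₀ B₀ : L2} {E B : LpL2 ∞ T}

lemma exists_LpL2_ae_eq {v : ℝ → L2} (hv : ContinuousOn v (Icc 0 T)) :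
    ∃ V : LpL2 ∞ T, V =ᵐ[volume.restrict (Ioo 0 T)] v := by
  obtain ⟨C, hC⟩ := isCompact_Icc.exists_bound_of_continuousOn hv
  have hmem : MemLp v ∞ (volume.restrict (Ioo 0 T)) :=
    memLp_top_of_bound ((hv.mono Ioo_subset_Icc_self).aestronglyMeasurable measurableSet_Ioo) C <|
      ae_restrict_of_forall_mem measurableSet_Ioo fun t ht => hC t (Ioo_subset_Icc_self ht)
  exact ⟨hmem.toLp, hmem.coeFn_toLp⟩

lemma intervalIntegrable_coeFn (hT : 0 ≤ T) (u : LpL2 1 T) : IntervalIntegrable u volume 0 T :=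
  (intervalIntegrable_iff_integrableOn_Ioo_of_le hT).2 (integrableOn_coeFn le_rfl u)

lemma setIntegral_Ioo_eq_intervalIntegral {H : Type*} [NormedAddCommGroup H] [NormedSpace ℝ H]
    {u v : ℝ → H} (hT : 0 ≤ T) (huv : u =ᵐ[volume.restrict (Ioo 0 T)] v) :
    ∫ t in Ioo 0 T, u t = ∫ t in (0 : ℝ)..T, v t := by
  rw [intervalIntegral.integral_of_le hT, integral_Ioc_eq_integral_Ioo, integral_congr_ae huv]

namespace IsSkewAdjointGraph

variable (hG : IsSkewAdjointGraph (maxwellGraph curlGraph p r))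

lemma isWeakSolution_of_ae_eq_mildFields (hT : 0 ≤ T) (hMP : IsMulOp MP fun x => actCLM (P x))
    (hR : IsMulOp R fun x => actCLM (Q x)⁻¹) (hp : IsSqrt p MP) (hr : IsSqrt r R)
    (hE : E =ᵐ[volume.restrict (Ioo 0 T)] fun t => (hG.mildFields E₀ B₀ f g t).1)
    (hB : B =ᵐ[volume.restrict (Ioo 0 T)] fun t => (hG.mildFields E₀ B₀ f g t).2) :
    IsWeakSolution T P Q f g E₀ B₀ E B := by
  have hf := intervalIntegrable_coeFn hT f
  have hg := intervalIntegrable_coeFn hT g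
  refine isWeakSolution_of_isTestCurve hMP hR (fun φ φ' ψ hφ => ?_) fun φ φ' ψ hφ => ?_
  · rw [setIntegral_Ioo_eq_intervalIntegral hT (ae_eq_refl fun t => inner ℂ (φ t) (f t)),
      ← hG.faraday_mildFields E₀ B₀ hp hr hf hg hφ]
    refine setIntegral_Ioo_eq_intervalIntegral hT ?_
    filter_upwards [hE, hB] with t hEt hBt
    rw [hEt, hBt]
  · rw [setIntegral_Ioo_eq_intervalIntegral hT (ae_eq_refl fun t => inner ℂ (φ t) (g t)),
      ← hG.ampere_mildFields E₀ B₀ hp hr hf hg hφ]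
    refine setIntegral_Ioo_eq_intervalIntegral hT ?_
    filter_upwards [hE, hB] with t hEt hBt
    rw [hEt, hBt]

lemma energyIdentity_of_ae_eq_mildFields (hT : 0 ≤ T) (hMP : IsMulOp MP fun x => actCLM (P x))
    (hR : IsMulOp R fun x => actCLM (Q x)⁻¹) (hp : IsSqrt p MP) (hr : IsSqrt r R)
    (hE : E =ᵐ[volume.restrict (Ioo 0 T)] fun t => (hG.mildFields E₀ B₀ f g t).1)
    (hB : B =ᵐ[volume.restrict (Ioo 0 T)] fun t => (hG.mildFields E₀ B₀ f g t).2) :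
    EnergyIdentity T P Q f g E₀ B₀ E B := by
  have hf := intervalIntegrable_coeFn hT f
  have hg := intervalIntegrable_coeFn hT g
  refine ⟨_, hG.absolutelyContinuousOnInterval_energy_mildFields E₀ B₀ hp hr hf hg, ?_, ?_, ?_⟩
  · rw [mildFields_zero, energy_eq hMP hR]
  · filter_upwards [hE, hB] with t hEt hBt
    rw [energy_eq hMP hR, hEt, hBt]
  · have hderiv := hG.ae_hasDerivAt_energy_mildFields E₀ B₀ hp hr hf hg
    filter_upwards [hE, hB, ae_restrict_of_ae hderiv, ae_restrict_mem measurableSet_Ioo]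
      with t hEt hBt ht htT
    rw [power_eq hR, hEt, hBt]
    exact ht (Ioo_subset_Icc_self.trans Icc_subset_uIcc htT)

end IsSkewAdjointGraph

lemma exists_isWeakSolution_energyIdentity (hT : 0 ≤ T) (hMP : IsMulOp MP fun x => actCLM (P x))
    (hMPpos : IsStrictlyPositive MP) (hR : IsMulOp R fun x => actCLM (Q x)⁻¹)
    (hRpos : IsStrictlyPositive R) (f g : LpL2 1 T) (E₀ B₀ : L2) :
    ∃ E B : LpL2 ∞ T, IsWeakSolution T P Q f g E₀ B₀ E B ∧
      EnergyIdentity T P Q f g E₀ B₀ E B := by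
  obtain ⟨p, hp⟩ := exists_isSqrt hMPpos
  obtain ⟨r, hr⟩ := exists_isSqrt hRpos
  have hG := isSkewAdjointGraph_maxwellGraph isSelfAdjointGraph_curlGraph hp hr
  have hcont := hG.continuousOn_mildFields E₀ B₀ (intervalIntegrable_coeFn hT f)
    (intervalIntegrable_coeFn hT g)
  rw [uIcc_of_le hT] at hcont
  obtain ⟨E, hE⟩ := exists_LpL2_ae_eq hcont.fst
  obtain ⟨B, hB⟩ := exists_LpL2_ae_eq hcont.snd
  exact ⟨E, B, hG.isWeakSolution_of_ae_eq_mildFields hT hMP hR hp hr hE hB,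
    hG.energyIdentity_of_ae_eq_mildFields hT hMP hR hp hr hE hB⟩

end WellPosedness

end Maxwell

end

theorem theorem3p1 (T : ℝ) (hT : 0 < T)
    (P Q : Maxwell.R3 → Matrix (Fin 3) (Fin 3) ℂ)
    (hP : Maxwell.IsBoundedCoeff P) (hQ : Maxwell.IsBoundedCoeff Q)
    (hPh : Maxwell.IsHermitianCoeff P) (hQh : Maxwell.IsHermitianCoeff Q)
    (hell : Maxwell.UniformlyElliptic P Q)
    (f g : Maxwell.LpL2 1 T) (E₀ B₀ : Maxwell.L2) :
    (∃! u : Maxwell.LpL2 ∞ T × Maxwell.LpL2 ∞ T,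
      Maxwell.IsWeakSolution T P Q f g E₀ B₀ u.1 u.2) ∧
    ∀ E B : Maxwell.LpL2 ∞ T, Maxwell.IsWeakSolution T P Q f g E₀ B₀ E B →
      Maxwell.EnergyIdentity T P Q f g E₀ B₀ E B := by
  obtain ⟨MP, R, hMP, hMPpos, hR, hRpos⟩ := hell.exists_isMulOp hP hQ hPh hQh
  obtain ⟨E, B, hsol, henergy⟩ :=
    Maxwell.exists_isWeakSolution_energyIdentity hT.le hMP hMPpos hR hRpos f g E₀ B₀
  refine ⟨⟨(E, B), hsol, fun u hu => ?_⟩, fun E' B' hsol' => ?_⟩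
  · exact Prod.ext_iff.2 (hu.eq_and_eq hsol hMP hMPpos hR hRpos)
  · obtain ⟨rfl, rfl⟩ := hsol'.eq_and_eq hsol hMP hMPpos hR hRpos
    exact henergy
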